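/- Let $\mathbb{H}^+=\{x+iy: x\ge 0,\ y\in\mathbb{R}\}$, embedded in $\mathbb{R}^3$ by $x+iy\mapsto(x,y,0)$, and let $\mathbf{R}_\phi$ denote rotation by the angle $\phi$ about the $y$-axis. For $A\subset\mathbb{H}^+$ put $\Gamma(A)=\{\mathbf{R}_\phi z: z\in A,\ 0\le\phi<2\pi\}\subset\mathbb{R}^3$. For $s>0$ and $z,w\in\mathbb{H}^+$ let $$\mathcal{K}_s(z,w)=\frac1{2\pi}\int_0^{2\pi}\frac{d\phi}{|\mathbf{R}_\phi z-w|^s}.$$ For a kernel $k\ge 0$ and a compact set $K$, an equilibrium measure on $K$ for $k$ is a Borel probability measure supported on $K$ that minimizes $\iint k(x,y)\,d\mu(x)\,d\mu(y)$ among all such measures. Let $A$ be a non-empty compact subset of either (a) a horizontal line-segment $[a+ic,\,b+ic]$ with $0<a<b$, $c\in\mathbb{R}$, or (b) a vertical line-segment $[R+ic,\,R+id]$ with $R>0$, $c<d$. Then for every $0<s<1$ the following holds. There is a unique equilibrium measure $\mu_{s,\Gamma(A)}$ on $\Gamma(A)$ for the Riesz kernel $|x-y|^{-s}$ on $\mathbb{R}^3$.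 The measure $\lambda_{s,A}$ on $\mathbb{H}^+$ given by $\lambda_{s,A}(B)=\mu_{s,\Gamma(A)}(\Gamma(B))$ for Borel sets $B\subset\mathbb{H}^+$ is the unique equilibrium measure on $A$ for the kernel $\mathcal{K}_s$. Moreover, $$\operatorname{supp}\lambda_{s,A}=A.$$ -/

import Mathlib

open MeasureTheory Set
open scoped ENNReal

noncomputable section

/-- The closed right half-plane `{x + i y | x ≥ 0}`. -/
def rightHalfPlane : Set ℂ := {z | 0 ≤ z.re}

/-- The reference half-plane inside `ℝ³`: `x + i y` is identified with `(x, y, 0)`; the axis of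
revolution is the `y`-axis. -/
def embedPlane (z : ℂ) : EuclideanSpace ℝ (Fin 3) := !₂[z.re, z.im, 0]

/-- Rotation of `ℝ³` by the angle `φ` about the `y`-axis. -/
def rotY (φ : ℝ) (p : EuclideanSpace ℝ (Fin 3)) : EuclideanSpace ℝ (Fin 3) :=
  !₂[Real.cos φ * p 0 + Real.sin φ * p 2, p 1, -Real.sin φ * p 0 + Real.cos φ * p 2]

/-- The set of revolution `Γ(A)`, obtained by rotating `A` about the `y`-axis. -/
def revolve (A : Set ℂ) : Set (EuclideanSpace ℝ (Fin 3)) :=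
  {p | ∃ z ∈ A, ∃ φ ∈ Ico (0 : ℝ) (2 * Real.pi), p = rotY φ (embedPlane z)}

/-- The Riesz `s`-kernel `|x - y|⁻ˢ` on `ℝ³`, with value `∞` on the diagonal (for `s > 0`). -/
def rieszKernel (s : ℝ) (p q : EuclideanSpace ℝ (Fin 3)) : ℝ≥0∞ := edist p q ^ (-s)

/-- The kernel `𝒦ₛ(z, w) = (1 / 2π) ∫₀^{2π} |R_φ z - w|⁻ˢ dφ` in the plane. -/
def axialKernel (s : ℝ) (z w : ℂ) : ℝ≥0∞ :=
  (ENNReal.ofReal (2 * Real.pi))⁻¹ *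
    ∫⁻ φ in Ico (0 : ℝ) (2 * Real.pi), rieszKernel s (rotY φ (embedPlane z)) (embedPlane w)

/-- The energy `∬ k(x, y) dμ(x) dμ(y)` of a measure for a nonnegative kernel. -/
def kernelEnergy {X : Type*} [MeasurableSpace X] (k : X → X → ℝ≥0∞) (μ : Measure X) : ℝ≥0∞ :=
  ∫⁻ x, ∫⁻ y, k x y ∂μ ∂μ

/-- `μ` is an equilibrium measure on the compact set `K` for the kernel `k`: a Borel probability
measure supported on `K` whose energy is minimal among all such measures. -/
structure IsEquilibriumMeasure {X : Type*} [MeasurableSpace X] (k : X → X → ℝ≥0∞) (K : Set X)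
    (μ : Measure X) : Prop where
  isProbabilityMeasure : IsProbabilityMeasure μ
  measure_compl : μ Kᶜ = 0
  energy_le : ∀ ν : Measure X, IsProbabilityMeasure ν → ν Kᶜ = 0 →
    kernelEnergy k μ ≤ kernelEnergy k ν

/-- The point of the half-plane that generates the circle through `p` around the `y`-axis. -/
def profile (p : EuclideanSpace ℝ (Fin 3)) : ℂ := ⟨Real.sqrt (p 0 ^ 2 + p 2 ^ 2), p 1⟩

/-- The measure `μ ∘ Γ` on the half-plane, which assigns to `B` the mass `μ (Γ(B))`
(see `measureOnSection_apply`). -/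
def measureOnSection (μ : Measure (EuclideanSpace ℝ (Fin 3))) : Measure ℂ := μ.map profile

theorem measurable_profile : Measurable profile := by
  have h : Continuous profile := by
    have : profile = fun p : EuclideanSpace ℝ (Fin 3) =>
        ((Real.sqrt (p 0 ^ 2 + p 2 ^ 2) : ℝ) : ℂ) + ((p 1 : ℝ) : ℂ) * Complex.I := by
      funext p
      apply Complex.ext <;> simp [profile]
    rw [this]
    fun_prop
  exact h.measurable

theorem revolve_eq_preimage {B : Set ℂ} (hB : B ⊆ rightHalfPlane) :
    revolve B = profile ⁻¹' B := by
  ext p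
  constructor
  · rintro ⟨z, hz, φ, -, rfl⟩
    have hz0 : 0 ≤ z.re := hB hz
    have : profile (rotY φ (embedPlane z)) = z := by
      apply Complex.ext
      · have h : (Real.cos φ * z.re) ^ 2 + (-(Real.sin φ * z.re)) ^ 2 = z.re ^ 2 := by
          linear_combination z.re ^ 2 * Real.sin_sq_add_cos_sq φ
        simp [profile, rotY, embedPlane]
        rw [show (Real.cos φ * z.re) ^ 2 + (Real.sin φ * z.re) ^ 2 = z.re ^ 2 by
          linear_combination h, Real.sqrt_sq hz0]
      · simp [profile, rotY, embedPlane]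
    simpa [this] using hz
  · intro hp
    have hinj : ((⟨p 0, -p 2⟩ : ℂ)).re = p 0 ∧ ((⟨p 0, -p 2⟩ : ℂ)).im = -p 2 := ⟨rfl, rfl⟩
    have hn : ‖(⟨p 0, -p 2⟩ : ℂ)‖ = Real.sqrt (p 0 ^ 2 + p 2 ^ 2) := by
      rw [Complex.norm_eq_sqrt_sq_add_sq]
      simp
    have hpi : (0 : ℝ) < 2 * Real.pi := Real.two_pi_pos
    obtain ⟨n, hn', -⟩ :=
      existsUnique_add_zsmul_mem_Ico hpi (Complex.arg ⟨p 0, -p 2⟩) 0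
    refine ⟨profile p, hp, Complex.arg ⟨p 0, -p 2⟩ + n • (2 * Real.pi), by simpa using hn', ?_⟩
    have hc : Real.cos (Complex.arg ⟨p 0, -p 2⟩ + n • (2 * Real.pi)) =
        Real.cos (Complex.arg ⟨p 0, -p 2⟩) := by
      rw [zsmul_eq_mul, Real.cos_add_int_mul_two_pi]
    have hs : Real.sin (Complex.arg ⟨p 0, -p 2⟩ + n • (2 * Real.pi)) =
        Real.sin (Complex.arg ⟨p 0, -p 2⟩) := by
      rw [zsmul_eq_mul, Real.sin_add_int_mul_two_pi]
    have h1 := Complex.norm_mul_cos_arg (⟨p 0, -p 2⟩ : ℂ)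
    have h2 := Complex.norm_mul_sin_arg (⟨p 0, -p 2⟩ : ℂ)
    rw [hn] at h1 h2
    ext i
    fin_cases i
    · simp only [rotY, embedPlane, hc, hs, profile]
      simp
      linarith
    · simp [rotY, embedPlane, profile]
    · simp only [rotY, embedPlane, hc, hs, profile]
      simp
      linarith

theorem measureOnSection_apply (μ : Measure (EuclideanSpace ℝ (Fin 3))) {B : Set ℂ}
    (hB : MeasurableSet B) (hB' : B ⊆ rightHalfPlane) :
    measureOnSection μ B = μ (revolve B) := by
  rw [measureOnSection, Measure.map_apply measurable_profile hB, revolve_eq_preimage hB']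

end

/-! Existence is the direct method: the Riesz kernel is continuous into `[0, ∞]`, so energy is lower
semicontinuous on the weakly compact space of probability measures on `Γ(A)`. Uniqueness is strict
positive definiteness: `|x - y|⁻ˢ` is a positive mixture of Gaussians `exp (-t |x - y|²)`, whose
quadratic form is a Gaussian-weighted `L²` norm of a difference of characteristic functions.
Uniqueness makes the equilibrium measure rotation invariant. Averaging over the angle identifies
invariant measures on `Γ(A)` with measures on `A` and turns Riesz energy into `𝒦ₛ` energy, so both
minimization problems are the same.

For the support, `|R_φ z - w| = c |1 - r e^{iφ}|` for suitable `c` and `r`, and Parseval applied to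
`(1 - r e^{iφ})^{-s/2}` gives `𝒦ₛ(z, w) = c⁻ˢ ∑ aₙ r^{2n}` with `aₙ ≥ 0`, `a₁ > 0`, for `0 ≤ r < 1`.
On a horizontal segment the terms are `w^{2n} z^{-(s+2n)}` for real parts `w < z`; on a vertical one
they are multiples of `exp (-(s+4n) arsinh (h/2R))`, `h` being the vertical distance. Thus, on
either side of `y`, `𝒦ₛ(·, y)` is strictly convex and strictly decreasing away from `y`.

Since `s < 1`, the kernel is finite on the diagonal, so point masses are admissible perturbations:
the potential is at least the minimal energy `W` everywhere on `A`, and equals `W` on the support. A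
point of `A` in a gap of the support would, by strict convexity (by monotonicity if it lies beyond
one end), have potential below `W`, a contradiction. The main steps are
`two_mul_mutualEnergy_rieszKernel_lt`, `IsEquilibriumMeasure.measureOnSection`, `circleMean_eq_tsum`
and `IsEquilibriumMeasure.support_eq_of_strictConvex`. -/

noncomputable section

/-! ### Existence of equilibrium measures -/

open Filter Topology BoundedContinuousFunction in
/-- The energy of a continuous kernel is lower semicontinuous for weak convergence. -/
theorem lowerSemicontinuous_lintegral_prod {X : Type*} [MetricSpace X]
    [SecondCountableTopology X] [MeasurableSpace X] [BorelSpace X] {k : X → X → ℝ≥0∞}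
    (hk : Continuous (Function.uncurry k)) :
    LowerSemicontinuous fun P : ProbabilityMeasure X =>
      ∫⁻ p, k p.1 p.2 ∂((P : Measure X).prod (P : Measure X)) := by
  -- Truncation at height `n` gives bounded continuous kernels, whose energies are weakly
  -- continuous; the full energy is their supremum.
  have hcont : ∀ n : ℕ, Continuous fun p : X × X => min (k p.1 p.2) (n : ℝ≥0∞) := fun n =>
    hk.min continuous_const
  have hsup : ∀ P : ProbabilityMeasure X,
      ∫⁻ p, k p.1 p.2 ∂((P : Measure X).prod (P : Measure X)) =
        ⨆ n : ℕ, ∫⁻ p, min (k p.1 p.2) (n : ℝ≥0∞) ∂((P : Measure X).prod (P : Measure X)) := by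
    intro P
    rw [← lintegral_iSup (fun n => (hcont n).measurable)]
    · refine lintegral_congr fun p => ?_
      apply le_antisymm
      · refine le_of_forall_lt fun c hc => ?_
        obtain ⟨n, hn⟩ := ENNReal.exists_nat_gt (ne_top_of_lt hc)
        exact lt_iSup_iff.2 ⟨n, lt_min hc hn⟩
      · exact iSup_le fun n => min_le_left _ _
    · intro m n hmn p
      exact min_le_min le_rfl (by exact_mod_cast hmn)
  simp_rw [hsup]
  refine lowerSemicontinuous_iSup fun n => Continuous.lowerSemicontinuous ?_
  have hprod : Continuous fun P : ProbabilityMeasure X => P.prod P :=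
    ProbabilityMeasure.continuous_prod.comp (continuous_id.prodMk continuous_id)
  have hfin : ∀ p : X × X, min (k p.1 p.2) (n : ℝ≥0∞) ≠ ∞ := fun p =>
    ne_top_of_le_ne_top (ENNReal.natCast_ne_top n) (min_le_right _ _)
  let f : X × X →ᵇ NNReal := BoundedContinuousFunction.mkOfBound
    ⟨fun p => (min (k p.1 p.2) (n : ℝ≥0∞)).toNNReal,
      ENNReal.continuousOn_toNNReal.comp_continuous (hcont n) hfin⟩ n (by
      intro p q
      have h : ∀ p : X × X, (min (k p.1 p.2) (n : ℝ≥0∞)).toNNReal ≤ n := fun p => by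
        rw [← ENNReal.coe_le_coe, ENNReal.coe_toNNReal (hfin p)]
        simp
      rw [NNReal.dist_eq, abs_le]
      have h1 : (((min (k p.1 p.2) (n : ℝ≥0∞)).toNNReal : NNReal) : ℝ) ≤ n := by
        exact_mod_cast h p
      have h2 : (((min (k q.1 q.2) (n : ℝ≥0∞)).toNNReal : NNReal) : ℝ) ≤ n := by
        exact_mod_cast h q
      have h3 := NNReal.coe_nonneg (min (k p.1 p.2) (n : ℝ≥0∞)).toNNReal
      have h4 := NNReal.coe_nonneg (min (k q.1 q.2) (n : ℝ≥0∞)).toNNReal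
      constructor <;> simp only [ContinuousMap.coe_mk] <;> linarith)
  have key : ∀ P : ProbabilityMeasure X,
      ∫⁻ p, min (k p.1 p.2) (n : ℝ≥0∞) ∂((P : Measure X).prod (P : Measure X)) =
        ∫⁻ p, f p ∂((P.prod P : ProbabilityMeasure (X × X)) : Measure (X × X)) := by
    intro P
    rw [ProbabilityMeasure.toMeasure_prod]
    refine lintegral_congr fun p => ?_
    exact (ENNReal.coe_toNNReal (hfin p)).symm
  simp_rw [key]
  rw [continuous_iff_continuousAt]
  intro P
  exact ProbabilityMeasure.tendsto_iff_forall_lintegral_tendsto.1 (hprod.tendsto P) f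

theorem kernelEnergy_eq_lintegral_prod {X : Type*} [MeasurableSpace X] {k : X → X → ℝ≥0∞}
    (hk : Measurable (Function.uncurry k)) (μ : Measure X) [SFinite μ] :
    kernelEnergy k μ = ∫⁻ p, k p.1 p.2 ∂(μ.prod μ) :=
  (lintegral_prod (Function.uncurry k) hk.aemeasurable).symm

theorem kernelEnergy_map {X Y : Type*} [MeasurableSpace X] [MeasurableSpace Y]
    {k : X → X → ℝ≥0∞} (hk : Measurable (Function.uncurry k)) {f : Y → X} (hf : Measurable f)
    (μ : Measure Y) [SFinite μ] :
    kernelEnergy k (μ.map f) = kernelEnergy (fun x y => k (f x) (f y)) μ := by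
  unfold kernelEnergy
  rw [lintegral_map hk.lintegral_prod_right hf]
  exact lintegral_congr fun x => lintegral_map (hk.comp measurable_prodMk_left) hf

/-- A continuous kernel admits an equilibrium measure on every nonempty compact set. -/
theorem exists_isEquilibriumMeasure {X : Type*} [MetricSpace X]
    [SecondCountableTopology X] [MeasurableSpace X] [BorelSpace X] {k : X → X → ℝ≥0∞}
    (hk : Continuous (Function.uncurry k)) {K : Set X} (hK : IsCompact K) (hne : K.Nonempty) :
    ∃ μ, IsEquilibriumMeasure k K μ := by
  have : CompactSpace K := isCompact_iff_compactSpace.1 hK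
  have : Nonempty K := hne.to_subtype
  have hKm : MeasurableSet K := hK.isClosed.measurableSet
  let k' : K → K → ℝ≥0∞ := fun x y => k x y
  have hk' : Continuous (Function.uncurry k') :=
    hk.comp ((continuous_subtype_val.comp continuous_fst).prodMk
      (continuous_subtype_val.comp continuous_snd))
  have : Nonempty (ProbabilityMeasure K) := ⟨diracProba (Classical.arbitrary K)⟩
  obtain ⟨P, -, hP⟩ := LowerSemicontinuousOn.exists_isMinOn (univ_nonempty) isCompact_univ
    ((lowerSemicontinuous_lintegral_prod hk').lowerSemicontinuousOn univ)
  refine ⟨(P : Measure K).map Subtype.val, ?_, ?_, ?_⟩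
  · exact Measure.isProbabilityMeasure_map measurable_subtype_coe.aemeasurable
  · rw [Measure.map_apply measurable_subtype_coe hKm.compl]
    simp
  · intro ν hν hνK
    -- A competitor carried by `K` is the image of a measure on the compact subtype, where the
    -- minimum was taken.
    have hmap : (ν.comap (Subtype.val : K → X)).map Subtype.val = ν := by
      rw [(MeasurableEmbedding.subtype_coe hKm).map_comap, Subtype.range_coe]
      exact Measure.restrict_eq_self_of_ae_mem hνK
    have : IsProbabilityMeasure (ν.comap (Subtype.val : K → X)) := by
      constructor
      have h := hν.measure_univ
      rw [← hmap, Measure.map_apply measurable_subtype_coe MeasurableSet.univ] at h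
      simpa using h
    rw [← hmap, kernelEnergy_map hk.measurable measurable_subtype_coe,
      kernelEnergy_map hk.measurable measurable_subtype_coe,
      kernelEnergy_eq_lintegral_prod (k := k') hk'.measurable,
      kernelEnergy_eq_lintegral_prod (k := k') hk'.measurable]
    exact hP (mem_univ (⟨ν.comap Subtype.val, this⟩ : ProbabilityMeasure K))

/-! ### Strict positive definiteness of Gaussian and Riesz kernels -/

/-- The mutual energy `∬ k(x, y) dν(y) dμ(x)` of two measures. -/
def mutualEnergy {X : Type*} [MeasurableSpace X] (k : X → X → ℝ≥0∞) (μ ν : Measure X) : ℝ≥0∞ :=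
  ∫⁻ x, ∫⁻ y, k x y ∂ν ∂μ

section Gaussian

variable {V : Type*} [NormedAddCommGroup V] [MeasurableSpace V]

/-- The mutual energy of two measures for the Gaussian kernel `exp (-t |x - y|²)`. -/
def gaussianEnergy (t : ℝ) (μ ν : Measure V) : ℝ :=
  ∫ p, Real.exp (-t * ‖p.1 - p.2‖ ^ 2) ∂(μ.prod ν)

theorem gaussianEnergy_nonneg (t : ℝ) (μ ν : Measure V) : 0 ≤ gaussianEnergy t μ ν :=
  integral_nonneg fun _ => (Real.exp_pos _).le

variable [InnerProductSpace ℝ V] [FiniteDimensional ℝ V] [BorelSpace V]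

theorem gaussianEnergy_comm (t : ℝ) (μ ν : Measure V) [SFinite μ] [SFinite ν] :
    gaussianEnergy t μ ν = gaussianEnergy t ν μ := by
  unfold gaussianEnergy
  rw [← Measure.prod_swap, integral_map measurable_swap.aemeasurable
    (by fun_prop)]
  simp [norm_sub_rev]

theorem integrable_gaussian_prod {t : ℝ} (ht : 0 ≤ t) (μ ν : Measure V) [IsFiniteMeasure μ]
    [IsFiniteMeasure ν] :
    Integrable (fun p : V × V => Real.exp (-t * ‖p.1 - p.2‖ ^ 2)) (μ.prod ν) := by
  refine Integrable.of_bound (by fun_prop) 1 (Filter.Eventually.of_forall fun p => ?_)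
  rw [Real.norm_of_nonneg (Real.exp_pos _).le, Real.exp_le_one_iff]
  nlinarith [sq_nonneg ‖p.1 - p.2‖]

/-- The Gaussian `exp (-t |x - y|²)` is, up to a constant, the Fourier transform of the fixed weight
`exp (-|v|²)` at frequency `2 √t (x - y)`. Fubini then separates `x` from `y` into two
characteristic functions. -/
theorem gaussianEnergy_eq_integral_charFun {t : ℝ} (ht : 0 ≤ t) (μ ν : Measure V)
    [IsFiniteMeasure μ] [IsFiniteMeasure ν] :
    ((Real.pi : ℂ) / 1) ^ ((Module.finrank ℝ V : ℂ) / 2) * (gaussianEnergy t μ ν : ℂ) =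
      ∫ v : V, Complex.exp (-1 * (‖v‖ : ℂ) ^ 2) *
        (charFun μ ((2 * √t) • v) * charFun ν (-((2 * √t) • v))) := by
  set τ := 2 * √t with hτ
  have hτ2 : τ ^ 2 = 4 * t := by
    rw [hτ, mul_pow, Real.sq_sqrt ht]; norm_num
  have hint : Integrable (Function.uncurry fun (v : V) (p : V × V) =>
      Complex.exp (-1 * (‖v‖ : ℂ) ^ 2 + Complex.I * (inner ℝ (τ • (p.1 - p.2)) v : ℝ)))
      (volume.prod (μ.prod ν)) := by
    have h1 : Integrable (fun v : V => Complex.exp (-1 * (‖v‖ : ℂ) ^ 2)) := by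
      simpa using GaussianFourier.integrable_cexp_neg_mul_sq_norm_add
        (b := 1) (V := V) (by simp) 0 0
    refine (h1.norm.comp_fst (μ.prod ν)).mono' (by fun_prop) (Filter.Eventually.of_forall ?_)
    rintro ⟨v, p⟩
    simp only [Function.uncurry, Complex.exp_add, norm_mul]
    rw [mul_comm Complex.I, Complex.norm_exp_ofReal_mul_I, mul_one]
  have h2 : ∀ p : V × V, ((Real.pi : ℂ) / 1) ^ ((Module.finrank ℝ V : ℂ) / 2) *
      ((Real.exp (-t * ‖p.1 - p.2‖ ^ 2) : ℝ) : ℂ) = ∫ v : V, Complex.exp (-1 * (‖v‖ : ℂ) ^ 2 +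
        Complex.I * (inner ℝ (τ • (p.1 - p.2)) v : ℝ)) := by
    intro p
    rw [GaussianFourier.integral_cexp_neg_mul_sq_norm_add (by simp)]
    congr 1
    push_cast
    congr 1
    rw [norm_smul, Complex.I_sq]
    push_cast
    have : ((‖τ‖ : ℝ) : ℂ) ^ 2 = 4 * t := by
      rw [← Complex.ofReal_pow, Real.norm_eq_abs, sq_abs, hτ2]; push_cast; ring
    rw [mul_pow, this]; ring
  have h3 : ∀ v : V, Complex.exp (-1 * (‖v‖ : ℂ) ^ 2) *
        (charFun μ (τ • v) * charFun ν (-(τ • v))) =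
      ∫ p : V × V, Complex.exp (-1 * (‖v‖ : ℂ) ^ 2 +
        Complex.I * (inner ℝ (τ • (p.1 - p.2)) v : ℝ)) ∂(μ.prod ν) := by
    intro v
    rw [charFun_apply, charFun_apply, ← integral_prod_mul, ← integral_const_mul]
    refine integral_congr_ae (Filter.Eventually.of_forall fun p => ?_)
    simp only [← Complex.exp_add]
    congr 1
    rw [inner_smul_left, inner_sub_left, inner_neg_right, inner_smul_right, inner_smul_right]
    simp
    ring
  simp_rw [h3]
  rw [integral_integral_swap hint]
  simp_rw [← h2]
  rw [integral_const_mul, gaussianEnergy, ← integral_complex_ofReal]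

/-- Strict positive definiteness of the Gaussian kernel. -/
theorem two_mul_gaussianEnergy_lt {t : ℝ} (ht : 0 < t) {μ ν : Measure V}
    [IsFiniteMeasure μ] [IsFiniteMeasure ν] (hne : μ ≠ ν) :
    2 * gaussianEnergy t μ ν < gaussianEnergy t μ μ + gaussianEnergy t ν ν := by
  set τ := 2 * √t with hτ
  have hτ0 : 0 < τ := by positivity
  have hcμ : Continuous (charFun μ) := continuous_charFun
  have hcν : Continuous (charFun ν) := continuous_charFun
  let F : V → ℝ := fun v =>
    Real.exp (-‖v‖ ^ 2) * ‖charFun μ (τ • v) - charFun ν (τ • v)‖ ^ 2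
  have hFc : Continuous F := by fun_prop
  have hF0 : 0 ≤ F := fun v => by positivity
  have hgi : Integrable (fun v : V => Complex.exp (-1 * (‖v‖ : ℂ) ^ 2)) := by
    simpa using GaussianFourier.integrable_cexp_neg_mul_sq_norm_add
      (b := 1) (V := V) (by simp) 0 0
  have hterm : ∀ (α β : Measure V) [IsFiniteMeasure α] [IsFiniteMeasure β],
      Integrable (fun v : V => Complex.exp (-1 * (‖v‖ : ℂ) ^ 2) *
        (charFun α (τ • v) * charFun β (-(τ • v)))) := by
    intro α β _ _
    have h1 : Continuous (charFun α) := continuous_charFun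
    have h2 : Continuous (charFun β) := continuous_charFun
    refine hgi.mul_bdd (c := α.real univ * β.real univ)
      (by fun_prop) (Filter.Eventually.of_forall fun v => ?_)
    rw [norm_mul]
    exact mul_le_mul (norm_charFun_le _) (norm_charFun_le _) (norm_nonneg _) measureReal_nonneg
  have hadd : ∀ (α β γ δ : Measure V) [IsFiniteMeasure α] [IsFiniteMeasure β]
      [IsFiniteMeasure γ] [IsFiniteMeasure δ],
      Integrable (fun v : V => Complex.exp (-1 * (‖v‖ : ℂ) ^ 2) *
        (charFun α (τ • v) * charFun β (-(τ • v))) + Complex.exp (-1 * (‖v‖ : ℂ) ^ 2) *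
        (charFun γ (τ • v) * charFun δ (-(τ • v)))) := fun α β γ δ _ _ _ _ =>
    (hterm α β).add (hterm γ δ)
  -- Since `charFun` at `-u` is the conjugate of its value at `u`, this is the expansion of the
  -- squared modulus of a difference.
  have hF : ∀ v, (F v : ℂ) =
      (Complex.exp (-1 * (‖v‖ : ℂ) ^ 2) * (charFun μ (τ • v) * charFun μ (-(τ • v))) +
        Complex.exp (-1 * (‖v‖ : ℂ) ^ 2) * (charFun ν (τ • v) * charFun ν (-(τ • v)))) -
      (Complex.exp (-1 * (‖v‖ : ℂ) ^ 2) * (charFun μ (τ • v) * charFun ν (-(τ • v))) +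
        Complex.exp (-1 * (‖v‖ : ℂ) ^ 2) * (charFun ν (τ • v) * charFun μ (-(τ • v)))) := by
    intro v
    simp only [F, charFun_neg]
    push_cast
    rw [← Complex.mul_conj']
    simp only [map_sub]
    ring_nf
  have hFi : Integrable F := by
    have : Integrable (fun v => (F v : ℂ)) := by
      simp_rw [hF]
      exact ((hterm μ μ).add (hterm ν ν)).sub ((hterm μ ν).add (hterm ν μ))
    simpa using this.re
  have hsum : ((∫ v, F v : ℝ) : ℂ) = ((Real.pi : ℂ) / 1) ^ ((Module.finrank ℝ V : ℂ) / 2) *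
      ((gaussianEnergy t μ μ + gaussianEnergy t ν ν - 2 * gaussianEnergy t μ ν : ℝ) : ℂ) := by
    rw [← integral_complex_ofReal]
    simp_rw [hF]
    rw [integral_sub (hadd μ μ ν ν) (hadd μ ν ν μ),
      integral_add (hterm μ μ) (hterm ν ν), integral_add (hterm μ ν) (hterm ν μ),
      ← gaussianEnergy_eq_integral_charFun ht.le, ← gaussianEnergy_eq_integral_charFun ht.le,
      ← gaussianEnergy_eq_integral_charFun ht.le, ← gaussianEnergy_eq_integral_charFun ht.le,
      gaussianEnergy_comm t ν μ]
    push_cast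
    ring
  have hpi : ((Real.pi : ℂ) / 1) ^ ((Module.finrank ℝ V : ℂ) / 2) =
      ((Real.pi ^ ((Module.finrank ℝ V : ℝ) / 2) : ℝ) : ℂ) := by
    rw [Complex.ofReal_cpow Real.pi_pos.le]; simp
  rw [hpi, ← Complex.ofReal_mul, Complex.ofReal_inj] at hsum
  have hpos : 0 < ∫ v, F v := by
    -- If the integral vanishes, the continuous integrand vanishes everywhere. The weight is
    -- positive and `τ ≠ 0`, so the characteristic functions agree at every frequency.
    refine lt_of_le_of_ne (integral_nonneg hF0) fun h0 => hne ?_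
    have h1 := (integral_eq_zero_iff_of_nonneg hF0 hFi).1 h0.symm
    have h2 : F = 0 := (Continuous.ae_eq_iff_eq volume hFc continuous_const).1 h1
    apply Measure.ext_of_charFun
    ext u
    have h3 := congrFun h2 (τ⁻¹ • u)
    simpa [F, smul_smul, hτ0.ne', Real.exp_ne_zero, sub_eq_zero] using h3
  have hp : 0 < Real.pi ^ ((Module.finrank ℝ V : ℝ) / 2) := by positivity
  rw [hsum] at hpos
  have := (mul_pos_iff_of_pos_left hp).1 hpos
  linarith

end Gaussian

/-- The Riesz kernel is a mixture of Gaussians. -/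
theorem gamma_mul_rieszKernel {s : ℝ} (hs : 0 < s) (p q : EuclideanSpace ℝ (Fin 3)) :
    ENNReal.ofReal (Real.Gamma (s / 2)) * rieszKernel s p q =
      ∫⁻ t in Ioi (0 : ℝ), ENNReal.ofReal (t ^ (s / 2 - 1)) *
        ENNReal.ofReal (Real.exp (-t * ‖p - q‖ ^ 2)) := by
  have hΓ : 0 < Real.Gamma (s / 2) := Real.Gamma_pos_of_pos (by positivity)
  rcases eq_or_ne p q with rfl | hpq
  · have h0 : rieszKernel s p p = ∞ := by simp [rieszKernel, ENNReal.zero_rpow_of_neg, hs]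
    rw [h0, ENNReal.mul_top (by simpa using hΓ)]
    symm
    simp only [sub_self, norm_zero]
    by_contra hfin
    -- On the diagonal both sides are infinite: no power of `t` is integrable over all of `(0, ∞)`.
    refine not_integrableOn_Ioi_rpow (s / 2 - 1) ⟨by fun_prop, ?_⟩
    rw [hasFiniteIntegral_iff_ofReal]
    · simpa [lt_top_iff_ne_top] using hfin
    · filter_upwards [self_mem_ae_restrict measurableSet_Ioi] with t ht
      exact Real.rpow_nonneg (le_of_lt ht) _
  · have hd : 0 < ‖p - q‖ := norm_pos_iff.2 (sub_ne_zero.2 hpq)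
    have h1 := Real.integral_rpow_mul_exp_neg_mul_Ioi (a := s / 2) (r := ‖p - q‖ ^ 2)
      (by positivity) (by positivity)
    have h2 : ((1 / ‖p - q‖ ^ 2) ^ (s / 2) : ℝ) = ‖p - q‖ ^ (-s) := by
      rw [one_div, Real.inv_rpow (by positivity), Real.rpow_neg hd.le, ← Real.rpow_natCast,
        ← Real.rpow_mul hd.le]
      congr 2; push_cast; ring
    have hnn : 0 ≤ᵐ[volume.restrict (Ioi (0 : ℝ))]
        fun t : ℝ => t ^ (s / 2 - 1) * Real.exp (-(‖p - q‖ ^ 2 * t)) := by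
      filter_upwards [self_mem_ae_restrict measurableSet_Ioi] with t ht
      have := Real.rpow_nonneg (le_of_lt ht) (s / 2 - 1)
      exact mul_nonneg this (Real.exp_pos _).le
    have h3 : Integrable (fun t : ℝ => t ^ (s / 2 - 1) * Real.exp (-(‖p - q‖ ^ 2 * t)))
        (volume.restrict (Ioi (0 : ℝ))) := by
      by_contra hni
      rw [integral_undef hni, h2] at h1
      have : 0 < ‖p - q‖ ^ (-s) * Real.Gamma (s / 2) := by positivity
      exact this.ne h1
    have h4 : ∫⁻ t in Ioi (0 : ℝ), ENNReal.ofReal (t ^ (s / 2 - 1)) *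
        ENNReal.ofReal (Real.exp (-t * ‖p - q‖ ^ 2)) = ∫⁻ t in Ioi (0 : ℝ),
          ENNReal.ofReal (t ^ (s / 2 - 1) * Real.exp (-(‖p - q‖ ^ 2 * t))) := by
      refine setLIntegral_congr_fun measurableSet_Ioi fun t ht => ?_
      rw [← ENNReal.ofReal_mul (Real.rpow_nonneg (le_of_lt ht) _)]
      congr 3; ring
    rw [h4, ← ofReal_integral_eq_lintegral_ofReal h3 hnn, h1, h2, mul_comm (_ ^ _),
      ENNReal.ofReal_mul hΓ.le, rieszKernel, edist_dist, dist_eq_norm,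
      ENNReal.ofReal_rpow_of_pos hd]

theorem continuous_rieszKernel (s : ℝ) : Continuous (Function.uncurry (rieszKernel s)) :=
  ENNReal.continuous_rpow_const.comp continuous_edist

theorem gamma_mul_mutualEnergy_rieszKernel {s : ℝ} (hs : 0 < s)
    (μ ν : Measure (EuclideanSpace ℝ (Fin 3))) [IsFiniteMeasure μ] [IsFiniteMeasure ν] :
    ENNReal.ofReal (Real.Gamma (s / 2)) * mutualEnergy (rieszKernel s) μ ν =
      ∫⁻ t in Ioi (0 : ℝ), ENNReal.ofReal (t ^ (s / 2 - 1)) *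
        ENNReal.ofReal (gaussianEnergy t μ ν) := by
  have hm : Measurable (Function.uncurry (rieszKernel s)) := (continuous_rieszKernel s).measurable
  have hm' : Measurable fun p : EuclideanSpace ℝ (Fin 3) × EuclideanSpace ℝ (Fin 3) =>
    rieszKernel s p.1 p.2 := hm
  have h1 : mutualEnergy (rieszKernel s) μ ν = ∫⁻ p, rieszKernel s p.1 p.2 ∂(μ.prod ν) :=
    (lintegral_prod (Function.uncurry (rieszKernel s)) hm.aemeasurable).symm
  rw [h1, ← lintegral_const_mul _ hm']
  simp_rw [gamma_mul_rieszKernel hs]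
  rw [lintegral_lintegral_swap (by fun_prop)]
  refine setLIntegral_congr_fun measurableSet_Ioi fun t ht => ?_
  rw [lintegral_const_mul _ (by fun_prop), gaussianEnergy,
    ofReal_integral_eq_lintegral_ofReal (integrable_gaussian_prod (le_of_lt ht) μ ν)
      (Filter.Eventually.of_forall fun p => (Real.exp_pos _).le)]

/-- Strict positive definiteness of the Riesz kernel. -/
theorem two_mul_mutualEnergy_rieszKernel_lt {s : ℝ} (hs : 0 < s)
    {μ ν : Measure (EuclideanSpace ℝ (Fin 3))} [IsFiniteMeasure μ] [IsFiniteMeasure ν]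
    (hμ : kernelEnergy (rieszKernel s) μ ≠ ∞) (hν : kernelEnergy (rieszKernel s) ν ≠ ∞)
    (hne : μ ≠ ν) :
    2 * mutualEnergy (rieszKernel s) μ ν <
      kernelEnergy (rieszKernel s) μ + kernelEnergy (rieszKernel s) ν := by
  have hΓ : 0 < ENNReal.ofReal (Real.Gamma (s / 2)) :=
    ENNReal.ofReal_pos.2 (Real.Gamma_pos_of_pos (by positivity))
  rw [← ENNReal.mul_lt_mul_iff_right hΓ.ne' ENNReal.ofReal_ne_top, mul_add, mul_left_comm,
    show kernelEnergy (rieszKernel s) μ = mutualEnergy (rieszKernel s) μ μ from rfl,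
    show kernelEnergy (rieszKernel s) ν = mutualEnergy (rieszKernel s) ν ν from rfl]
  have hfin : ENNReal.ofReal (Real.Gamma (s / 2)) * mutualEnergy (rieszKernel s) μ μ +
      ENNReal.ofReal (Real.Gamma (s / 2)) * mutualEnergy (rieszKernel s) ν ν ≠ ∞ :=
    ENNReal.add_ne_top.2 ⟨ENNReal.mul_ne_top ENNReal.ofReal_ne_top hμ,
      ENNReal.mul_ne_top ENNReal.ofReal_ne_top hν⟩
  simp_rw [gamma_mul_mutualEnergy_rieszKernel hs] at hfin ⊢
  have hmeas : ∀ (α β : Measure (EuclideanSpace ℝ (Fin 3))) [IsFiniteMeasure α]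
      [IsFiniteMeasure β], Measurable fun t : ℝ => ENNReal.ofReal (t ^ (s / 2 - 1)) *
        ENNReal.ofReal (gaussianEnergy t α β) := by
    intro α β _ _
    have : StronglyMeasurable fun t : ℝ => gaussianEnergy t α β :=
      StronglyMeasurable.integral_prod_right (ν := α.prod β)
        (f := fun (t : ℝ) (p : EuclideanSpace ℝ (Fin 3) × EuclideanSpace ℝ (Fin 3)) =>
          Real.exp (-t * ‖p.1 - p.2‖ ^ 2)) (by
            apply Continuous.stronglyMeasurable; fun_prop)
    have h2 := this.measurable
    fun_prop
  rw [← lintegral_const_mul _ (hmeas μ ν), ← lintegral_add_left (hmeas μ μ)] at *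
  -- The inequality is strict for every `t > 0`; finiteness of the two energies keeps it strict
  -- after integration over `t`.
  have hlt : ∀ t : ℝ, 0 < t → 2 * (ENNReal.ofReal (t ^ (s / 2 - 1)) *
        ENNReal.ofReal (gaussianEnergy t μ ν)) < ENNReal.ofReal (t ^ (s / 2 - 1)) *
        ENNReal.ofReal (gaussianEnergy t μ μ) + ENNReal.ofReal (t ^ (s / 2 - 1)) *
        ENNReal.ofReal (gaussianEnergy t ν ν) := by
    intro t ht
    have h1 := two_mul_gaussianEnergy_lt ht hne
    have h2 : 0 < t ^ (s / 2 - 1) := by positivity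
    rw [← mul_add, mul_left_comm, ENNReal.mul_lt_mul_iff_right (by simpa using h2)
      ENNReal.ofReal_ne_top, ← ENNReal.ofReal_add (gaussianEnergy_nonneg t μ μ)
      (gaussianEnergy_nonneg t ν ν)]
    calc 2 * ENNReal.ofReal (gaussianEnergy t μ ν)
        = ENNReal.ofReal (2 * gaussianEnergy t μ ν) := by
          rw [ENNReal.ofReal_mul (by norm_num), ENNReal.ofReal_ofNat]
      _ < _ := ?_
    refine (ENNReal.ofReal_lt_ofReal_iff_of_nonneg ?_).2 h1
    exact mul_nonneg (by norm_num) (gaussianEnergy_nonneg t μ ν)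
  have hae := ae_restrict_of_forall_mem (μ := volume) (measurableSet_Ioi (a := (0 : ℝ)))
    (fun t ht => hlt t ht)
  refine lintegral_strict_mono ?_ ((hmeas μ μ).add (hmeas ν ν)).aemeasurable ?_ hae
  · simp
  · exact ne_top_of_le_ne_top hfin (lintegral_mono_ae (hae.mono fun _ h => h.le))

/-! ### Uniqueness of Riesz equilibrium measures -/

theorem mutualEnergy_comm {X : Type*} [MeasurableSpace X] {k : X → X → ℝ≥0∞}
    (hk : Measurable (Function.uncurry k)) (hsymm : ∀ x y, k x y = k y x)
    (μ ν : Measure X) [SFinite μ] [SFinite ν] : mutualEnergy k μ ν = mutualEnergy k ν μ := by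
  unfold mutualEnergy
  rw [lintegral_lintegral_swap hk.aemeasurable]
  simp_rw [hsymm]

theorem kernelEnergy_add_smul {X : Type*} [MeasurableSpace X] {k : X → X → ℝ≥0∞}
    (hk : Measurable (Function.uncurry k)) (hsymm : ∀ x y, k x y = k y x)
    (μ ν : Measure X) [SFinite μ] [SFinite ν] (a b : ℝ≥0∞) :
    kernelEnergy k (a • μ + b • ν) =
      a * (a * kernelEnergy k μ) + 2 * (a * (b * mutualEnergy k μ ν)) +
        b * (b * kernelEnergy k ν) := by
  have hm : ∀ (ρ : Measure X) [SFinite ρ], Measurable fun x => ∫⁻ y, k x y ∂ρ := fun ρ _ =>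
    hk.lintegral_prod_right
  have hc := mutualEnergy_comm hk hsymm μ ν
  unfold kernelEnergy mutualEnergy at *
  simp only [lintegral_add_measure, lintegral_smul_measure, smul_eq_mul]
  rw [lintegral_add_left ((hm μ).const_mul a), lintegral_add_left ((hm μ).const_mul a),
    lintegral_const_mul _ (hm _), lintegral_const_mul _ (hm _), lintegral_const_mul _ (hm _),
    lintegral_const_mul _ (hm _), ← hc]
  ring

theorem rieszKernel_comm (s : ℝ) (p q : EuclideanSpace ℝ (Fin 3)) :
    rieszKernel s p q = rieszKernel s q p := by
  simp [rieszKernel, edist_comm]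

/-- Equilibrium measures of finite energy for the Riesz kernel are unique. -/
theorem IsEquilibriumMeasure.eq_of_rieszKernel {s : ℝ} (hs : 0 < s)
    {K : Set (EuclideanSpace ℝ (Fin 3))} {μ ν : Measure (EuclideanSpace ℝ (Fin 3))}
    (hμ : IsEquilibriumMeasure (rieszKernel s) K μ)
    (hν : IsEquilibriumMeasure (rieszKernel s) K ν)
    (hfin : kernelEnergy (rieszKernel s) μ ≠ ∞) : μ = ν := by
  have := hμ.isProbabilityMeasure
  have := hν.isProbabilityMeasure
  by_contra hne
  have heq : kernelEnergy (rieszKernel s) ν = kernelEnergy (rieszKernel s) μ :=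
    le_antisymm (hν.energy_le μ ‹_› hμ.measure_compl) (hμ.energy_le ν ‹_› hν.measure_compl)
  have h1 := two_mul_mutualEnergy_rieszKernel_lt hs hfin (heq ▸ hfin) hne
  have hhalf : (2 : ℝ≥0∞)⁻¹ + 2⁻¹ = 1 := ENNReal.inv_two_add_inv_two
  have h2 : kernelEnergy (rieszKernel s) μ ≤
      kernelEnergy (rieszKernel s) ((2 : ℝ≥0∞)⁻¹ • μ + (2 : ℝ≥0∞)⁻¹ • ν) := by
    refine hμ.energy_le _ ⟨by simp [hhalf]⟩ ?_
    simp [hμ.measure_compl, hν.measure_compl]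
  -- With `W` the common energy and `I` the mutual energy, the midpoint has energy `(W + I) / 2`.
  -- Minimality gives `W ≤ I`, while positive definiteness gives `I < W`.
  rw [kernelEnergy_add_smul (continuous_rieszKernel s).measurable (rieszKernel_comm s)] at h2
  rw [heq] at h1 h2
  have hI : mutualEnergy (rieszKernel s) μ ν ≠ ∞ := by
    intro h
    rw [h] at h1
    simp at h1
  lift kernelEnergy (rieszKernel s) μ to NNReal using hfin with m
  lift mutualEnergy (rieszKernel s) μ ν to NNReal using hI with i
  rw [show (2 : ℝ≥0∞)⁻¹ = ((2⁻¹ : NNReal) : ℝ≥0∞) by simp] at h2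
  norm_cast at h1 h2
  rw [← NNReal.coe_lt_coe] at h1
  rw [← NNReal.coe_le_coe] at h2
  push_cast at h1 h2
  linarith

/-! ### Rotations and reduction to the half-plane -/

/-- The normalized Lebesgue measure on `[0, 2π)`. -/
def angleMeasure : Measure ℝ :=
  (ENNReal.ofReal (2 * Real.pi))⁻¹ • volume.restrict (Ico (0 : ℝ) (2 * Real.pi))

instance isProbabilityMeasure_angleMeasure : IsProbabilityMeasure angleMeasure := by
  constructor
  simp only [angleMeasure, Measure.smul_apply, Measure.restrict_apply_univ, Real.volume_Ico,
    sub_zero, smul_eq_mul]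
  exact ENNReal.inv_mul_cancel (by simpa using Real.pi_pos) ENNReal.ofReal_ne_top

theorem lintegral_angleMeasure (f : ℝ → ℝ≥0∞) : ∫⁻ φ, f φ ∂angleMeasure =
    (ENNReal.ofReal (2 * Real.pi))⁻¹ * ∫⁻ φ in Ico (0 : ℝ) (2 * Real.pi), f φ := by
  rw [angleMeasure, lintegral_smul_measure, smul_eq_mul]

theorem lintegral_angleMeasure_add {f : ℝ → ℝ≥0∞} (hf : Function.Periodic f (2 * Real.pi))
    (a : ℝ) : ∫⁻ φ, f (φ + a) ∂angleMeasure = ∫⁻ φ, f φ ∂angleMeasure := by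
  rw [lintegral_angleMeasure, lintegral_angleMeasure]
  congr 1
  have h1 : ∫⁻ φ in Ico (0 : ℝ) (2 * Real.pi), f (φ + a) =
      ∫⁻ φ in Ico a (a + 2 * Real.pi), f φ := by
    rw [← (measurePreserving_add_right volume a).setLIntegral_comp_preimage_emb
      (measurableEmbedding_addRight a) f]
    simp [add_comm]
  rw [h1, setLIntegral_congr Ico_ae_eq_Ioc, setLIntegral_congr (Ico_ae_eq_Ioc (a := 0))]
  have h2 := (isAddFundamentalDomain_Ioc Real.two_pi_pos a).setLIntegral_eq
    (isAddFundamentalDomain_Ioc Real.two_pi_pos 0) f hf.map_vadd_zmultiples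
  simpa using h2

theorem rotY_add (φ ψ : ℝ) (p : EuclideanSpace ℝ (Fin 3)) :
    rotY φ (rotY ψ p) = rotY (φ + ψ) p := by
  ext i
  fin_cases i <;> simp [rotY, Real.cos_add, Real.sin_add] <;> ring

theorem rotY_zero (p : EuclideanSpace ℝ (Fin 3)) : rotY 0 p = p := by
  ext i
  fin_cases i <;> simp [rotY]

theorem rotY_add_two_pi (φ : ℝ) (p : EuclideanSpace ℝ (Fin 3)) :
    rotY (φ + 2 * Real.pi) p = rotY φ p := by
  simp [rotY]

theorem dist_rotY (φ : ℝ) (p q : EuclideanSpace ℝ (Fin 3)) :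
    dist (rotY φ p) (rotY φ q) = dist p q := by
  simp only [EuclideanSpace.dist_eq, Fin.sum_univ_three, Real.dist_eq, sq_abs]
  congr 1
  simp only [rotY, PiLp.toLp_apply, Matrix.cons_val]
  linear_combination ((p 0 - q 0) ^ 2 + (p 2 - q 2) ^ 2) * Real.sin_sq_add_cos_sq φ

theorem rieszKernel_rotY (s φ : ℝ) (p q : EuclideanSpace ℝ (Fin 3)) :
    rieszKernel s (rotY φ p) (rotY φ q) = rieszKernel s p q := by
  simp [rieszKernel, edist_dist, dist_rotY]

theorem profile_rotY (φ : ℝ) (p : EuclideanSpace ℝ (Fin 3)) :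
    profile (rotY φ p) = profile p := by
  apply Complex.ext
  · simp only [profile, rotY, PiLp.toLp_apply, Matrix.cons_val]
    congr 1
    linear_combination (p 0 ^ 2 + p 2 ^ 2) * Real.sin_sq_add_cos_sq φ
  · simp [profile, rotY]

theorem profile_embedPlane {z : ℂ} (hz : z ∈ rightHalfPlane) : profile (embedPlane z) = z := by
  apply Complex.ext
  · have : 0 ≤ z.re := hz
    simp [profile, embedPlane, Real.sqrt_sq this]
  · simp [profile, embedPlane]

theorem exists_eq_rotY_embedPlane_profile (p : EuclideanSpace ℝ (Fin 3)) :
    ∃ φ, p = rotY φ (embedPlane (profile p)) := by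
  have h : p ∈ revolve {profile p} := by
    rw [revolve_eq_preimage]
    · rfl
    · rintro _ rfl
      exact Real.sqrt_nonneg _
  obtain ⟨z, rfl, φ, -, h⟩ := h
  exact ⟨φ, h⟩

@[fun_prop]
theorem continuous_embedPlane : Continuous embedPlane := by
  rw [← (PiLp.homeomorph 2 fun _ : Fin 3 => ℝ).comp_continuous_iff]
  refine continuous_pi fun i => ?_
  fin_cases i <;> simp [embedPlane] <;> fun_prop

@[fun_prop]
theorem Continuous.rotY {X : Type*} [TopologicalSpace X] {f : X → ℝ}
    {g : X → EuclideanSpace ℝ (Fin 3)} (hf : Continuous f) (hg : Continuous g) :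
    Continuous fun x => rotY (f x) (g x) := by
  rw [← (PiLp.homeomorph 2 fun _ : Fin 3 => ℝ).comp_continuous_iff]
  refine continuous_pi fun i => ?_
  fin_cases i <;> simp [_root_.rotY] <;> fun_prop

@[fun_prop]
theorem Continuous.rieszKernel {X : Type*} [TopologicalSpace X] (s : ℝ)
    {f g : X → EuclideanSpace ℝ (Fin 3)} (hf : Continuous f) (hg : Continuous g) :
    Continuous fun x => rieszKernel s (f x) (g x) :=
  ENNReal.continuous_rpow_const.comp (hf.edist hg)

theorem continuous_rotY_embedPlane : Continuous fun x : ℂ × ℝ => rotY x.2 (embedPlane x.1) := by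
  fun_prop

theorem continuous_rotY_left (φ : ℝ) : Continuous (rotY φ) := by
  fun_prop

/-- The rotation-invariant measure on `ℝ³` generated by a measure on the half-plane. -/
def revolveMeasure (ν : Measure ℂ) : Measure (EuclideanSpace ℝ (Fin 3)) :=
  (ν.prod angleMeasure).map fun x => rotY x.2 (embedPlane x.1)

instance isProbabilityMeasure_revolveMeasure (ν : Measure ℂ) [IsProbabilityMeasure ν] :
    IsProbabilityMeasure (revolveMeasure ν) :=
  Measure.isProbabilityMeasure_map continuous_rotY_embedPlane.aemeasurable

instance sFinite_revolveMeasure (ν : Measure ℂ) [SFinite ν] : SFinite (revolveMeasure ν) := by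
  unfold revolveMeasure
  infer_instance

theorem lintegral_revolveMeasure (ν : Measure ℂ) [SFinite ν]
    {f : EuclideanSpace ℝ (Fin 3) → ℝ≥0∞} (hf : Measurable f) :
    ∫⁻ p, f p ∂revolveMeasure ν = ∫⁻ z, ∫⁻ φ, f (rotY φ (embedPlane z)) ∂angleMeasure ∂ν := by
  have hm : Measurable fun x : ℂ × ℝ => f (rotY x.2 (embedPlane x.1)) :=
    hf.comp continuous_rotY_embedPlane.measurable
  rw [revolveMeasure, lintegral_map hf continuous_rotY_embedPlane.measurable,
    lintegral_prod _ hm.aemeasurable]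

theorem axialKernel_eq (s : ℝ) (z w : ℂ) : axialKernel s z w =
    ∫⁻ φ, rieszKernel s (rotY φ (embedPlane z)) (embedPlane w) ∂angleMeasure := by
  rw [lintegral_angleMeasure, axialKernel]

theorem measurable_axialKernel (s : ℝ) : Measurable (Function.uncurry (axialKernel s)) := by
  have h : Continuous fun x : (ℂ × ℂ) × ℝ =>
      rieszKernel s (rotY x.2 (embedPlane x.1.1)) (embedPlane x.1.2) := by
    fun_prop
  have h2 := h.measurable.lintegral_prod_right' (ν := angleMeasure)
  convert h2 using 1
  funext x
  exact axialKernel_eq s x.1 x.2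

/-- The distance between two rotated points depends only on the difference of the angles. Of the two
angular averages, one produces `axialKernel` and the other integrates a constant against a
probability measure. -/
theorem kernelEnergy_revolveMeasure (s : ℝ) (ν : Measure ℂ) [SFinite ν] :
    kernelEnergy (rieszKernel s) (revolveMeasure ν) = kernelEnergy (axialKernel s) ν := by
  have hr := (continuous_rieszKernel s).measurable
  have hinner : ∀ z w : ℂ, ∫⁻ φ, ∫⁻ ψ, rieszKernel s (rotY φ (embedPlane z))
      (rotY ψ (embedPlane w)) ∂angleMeasure ∂angleMeasure = axialKernel s z w := by
    intro z w
    have hm : Measurable (Function.uncurry fun φ ψ : ℝ => rieszKernel s (rotY φ (embedPlane z))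
        (rotY ψ (embedPlane w))) := by
      apply Continuous.measurable
      unfold Function.uncurry
      fun_prop
    rw [lintegral_lintegral_swap hm.aemeasurable]
    have : ∀ ψ : ℝ, ∫⁻ φ, rieszKernel s (rotY φ (embedPlane z))
      (rotY ψ (embedPlane w)) ∂angleMeasure = axialKernel s z w := by
      intro ψ
      have h1 : ∀ φ, rieszKernel s (rotY φ (embedPlane z)) (rotY ψ (embedPlane w)) =
          rieszKernel s (rotY (φ + -ψ) (embedPlane z)) (embedPlane w) := by
        intro φ
        rw [← rieszKernel_rotY s (-ψ), rotY_add, rotY_add, neg_add_cancel, rotY_zero, add_comm]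
      simp_rw [h1]
      rw [lintegral_angleMeasure_add
        (f := fun φ => rieszKernel s (rotY φ (embedPlane z)) (embedPlane w)), axialKernel_eq]
      intro φ
      simp only [rotY_add_two_pi]
    simp [this]
  unfold kernelEnergy
  rw [lintegral_revolveMeasure ν hr.lintegral_prod_right]
  refine lintegral_congr fun z => ?_
  simp_rw [← hinner]
  rw [lintegral_lintegral_swap (f := fun w φ => ∫⁻ ψ, rieszKernel s (rotY φ (embedPlane z))
    (rotY ψ (embedPlane w)) ∂angleMeasure)]
  · refine lintegral_congr fun φ => ?_
    exact lintegral_revolveMeasure ν (f := fun q => rieszKernel s (rotY φ (embedPlane z)) q)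
      (Continuous.measurable (by fun_prop))
  · have : Measurable fun x : (ℂ × ℝ) × ℝ => rieszKernel s (rotY x.1.2 (embedPlane z))
      (rotY x.2 (embedPlane x.1.1)) := by
      apply Continuous.measurable
      fun_prop
    exact (this.lintegral_prod_right' (ν := angleMeasure)).aemeasurable

theorem measureOnSection_revolveMeasure {ν : Measure ℂ} [SFinite ν]
    (hν : ν rightHalfPlaneᶜ = 0) : measureOnSection (revolveMeasure ν) = ν := by
  have h : ∀ᵐ x ∂(ν.prod angleMeasure), profile (rotY x.2 (embedPlane x.1)) = x.1 := by
    have h1 : ∀ᵐ z ∂ν, z ∈ rightHalfPlane := hν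
    filter_upwards [Measure.quasiMeasurePreserving_fst.ae h1] with x hx
    rw [profile_rotY, profile_embedPlane hx]
  rw [measureOnSection, revolveMeasure, Measure.map_map measurable_profile
    continuous_rotY_embedPlane.measurable]
  refine (Measure.map_congr h).trans ?_
  simp

/-- A point and its profile lie on the same circle, so they have the same angular average. Replacing
one by the other turns the revolved measure into the average of the rotations of `μ`, which are all
equal to `μ`. -/
theorem revolveMeasure_measureOnSection {μ : Measure (EuclideanSpace ℝ (Fin 3))} [SFinite μ]
    (hμ : ∀ φ, μ.map (rotY φ) = μ) : revolveMeasure (measureOnSection μ) = μ := by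
  have : SFinite (measureOnSection μ) := by unfold measureOnSection; infer_instance
  ext B hB
  have hf : Measurable (B.indicator (1 : EuclideanSpace ℝ (Fin 3) → ℝ≥0∞)) :=
    measurable_one.indicator hB
  have hm : Measurable fun x : EuclideanSpace ℝ (Fin 3) × ℝ =>
      B.indicator (1 : EuclideanSpace ℝ (Fin 3) → ℝ≥0∞) (rotY x.2 x.1) :=
    hf.comp (continuous_snd.rotY continuous_fst).measurable
  have hm2 : Measurable fun x : ℂ × ℝ =>
      B.indicator (1 : EuclideanSpace ℝ (Fin 3) → ℝ≥0∞) (rotY x.2 (embedPlane x.1)) :=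
    hf.comp continuous_rotY_embedPlane.measurable
  rw [← lintegral_indicator_one hB, ← lintegral_indicator_one hB, lintegral_revolveMeasure _ hf,
    measureOnSection, lintegral_map hm2.lintegral_prod_right' measurable_profile]
  have h1 : ∀ p, ∫⁻ φ, B.indicator (1 : EuclideanSpace ℝ (Fin 3) → ℝ≥0∞)
      (rotY φ (embedPlane (profile p))) ∂angleMeasure =
      ∫⁻ φ, B.indicator (1 : EuclideanSpace ℝ (Fin 3) → ℝ≥0∞) (rotY φ p) ∂angleMeasure := by
    intro p
    obtain ⟨α, hα⟩ := exists_eq_rotY_embedPlane_profile p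
    conv_rhs => rw [hα]
    simp_rw [rotY_add]
    rw [lintegral_angleMeasure_add (f := fun φ =>
      B.indicator (1 : EuclideanSpace ℝ (Fin 3) → ℝ≥0∞) (rotY φ (embedPlane (profile p))))]
    intro φ
    simp only [rotY_add_two_pi]
  simp_rw [h1]
  rw [lintegral_lintegral_swap hm.aemeasurable]
  have h2 : ∀ φ, ∫⁻ p, B.indicator (1 : EuclideanSpace ℝ (Fin 3) → ℝ≥0∞) (rotY φ p) ∂μ =
      ∫⁻ p, B.indicator (1 : EuclideanSpace ℝ (Fin 3) → ℝ≥0∞) p ∂μ := by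
    intro φ
    conv_rhs => rw [← hμ φ, lintegral_map hf (continuous_rotY_left φ).measurable]
  simp [h2]

/-- The Riesz equilibrium measure of a set of revolution is invariant under rotations. -/
theorem IsEquilibriumMeasure.map_rotY {s : ℝ} (hs : 0 < s) {A : Set ℂ} (hA : MeasurableSet A)
    (hA' : A ⊆ rightHalfPlane) {μ : Measure (EuclideanSpace ℝ (Fin 3))}
    (hμ : IsEquilibriumMeasure (rieszKernel s) (revolve A) μ)
    (hfin : kernelEnergy (rieszKernel s) μ ≠ ∞) (φ : ℝ) : μ.map (rotY φ) = μ := by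
  have := hμ.isProbabilityMeasure
  have hm : Measurable (rotY φ) := (continuous_rotY_left φ).measurable
  have hE : kernelEnergy (rieszKernel s) (μ.map (rotY φ)) = kernelEnergy (rieszKernel s) μ := by
    rw [kernelEnergy_map (continuous_rieszKernel s).measurable hm]
    simp_rw [rieszKernel_rotY]
  refine (hμ.eq_of_rieszKernel hs ⟨?_, ?_, ?_⟩ hfin).symm
  · exact Measure.isProbabilityMeasure_map hm.aemeasurable
  · have h := hμ.measure_compl
    rw [revolve_eq_preimage hA'] at h ⊢
    rw [Measure.map_apply hm (measurable_profile hA).compl, preimage_compl, ← preimage_comp]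
    simpa [Function.comp_def, profile_rotY] using h
  · rw [hE]
    exact hμ.energy_le

/-- The Riesz equilibrium problem on a set of revolution is equivalent to the equilibrium problem
for the axial kernel on its section. -/
theorem IsEquilibriumMeasure.measureOnSection {s : ℝ} (hs : 0 < s) {A : Set ℂ}
    (hA : MeasurableSet A) (hA' : A ⊆ rightHalfPlane) {μ : Measure (EuclideanSpace ℝ (Fin 3))}
    (hμ : IsEquilibriumMeasure (rieszKernel s) (revolve A) μ)
    (hfin : kernelEnergy (rieszKernel s) μ ≠ ∞) :
    IsEquilibriumMeasure (axialKernel s) A (measureOnSection μ) ∧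
      ∀ ν, IsEquilibriumMeasure (axialKernel s) A ν → ν = measureOnSection μ := by
  have := hμ.isProbabilityMeasure
  have hprob : IsProbabilityMeasure (_root_.measureOnSection μ) :=
    Measure.isProbabilityMeasure_map measurable_profile.aemeasurable
  have hrev := revolveMeasure_measureOnSection (hμ.map_rotY hs hA hA' hfin)
  have hcompl : _root_.measureOnSection μ Aᶜ = 0 := by
    rw [_root_.measureOnSection, Measure.map_apply measurable_profile hA.compl, preimage_compl,
      ← revolve_eq_preimage hA']
    exact hμ.measure_compl
  have hE : kernelEnergy (axialKernel s) (_root_.measureOnSection μ) =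
      kernelEnergy (rieszKernel s) μ := by
    rw [← kernelEnergy_revolveMeasure, hrev]
  have hnull : ∀ ν : Measure ℂ, ν Aᶜ = 0 → ν rightHalfPlaneᶜ = 0 := fun ν hν =>
    measure_mono_null (compl_subset_compl.2 hA') hν
  have hlift : ∀ ν : Measure ℂ, IsProbabilityMeasure ν → ν Aᶜ = 0 →
      revolveMeasure ν (revolve A)ᶜ = 0 := by
    intro ν _ hν
    rw [revolve_eq_preimage hA', ← preimage_compl, ← Measure.map_apply measurable_profile hA.compl]
    change _root_.measureOnSection (revolveMeasure ν) Aᶜ = 0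
    rw [measureOnSection_revolveMeasure (hnull ν hν), hν]
  refine ⟨⟨hprob, hcompl, fun ν hν hνA => ?_⟩, fun ν hν => ?_⟩
  · rw [hE, ← kernelEnergy_revolveMeasure]
    exact hμ.energy_le _ inferInstance (hlift ν hν hνA)
  · have := hν.isProbabilityMeasure
    -- A planar equilibrium measure lifts to a minimizer in space, so planar uniqueness follows from
    -- spatial uniqueness.
    have heq : μ = revolveMeasure ν := by
      refine hμ.eq_of_rieszKernel hs ⟨inferInstance, hlift ν this hν.measure_compl, ?_⟩ hfin
      intro ρ hρ hρA
      rw [kernelEnergy_revolveMeasure]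
      exact (hν.energy_le _ hprob hcompl).trans (hE ▸ hμ.energy_le ρ hρ hρA)
    rw [heq, measureOnSection_revolveMeasure (hnull ν hν.measure_compl)]

/-- Allowing the angle `2π` adds no points, and the closed angular interval presents the set as a
continuous image of a compact product. -/
theorem isCompact_revolve {A : Set ℂ} (hA : IsCompact A) : IsCompact (revolve A) := by
  have h : revolve A ⊆ (fun x : ℂ × ℝ => rotY x.2 (embedPlane x.1)) ''
      (A ×ˢ Icc 0 (2 * Real.pi)) := by
    rintro p ⟨z, hz, φ, hφ, rfl⟩
    exact ⟨(z, φ), ⟨hz, hφ.1, hφ.2.le⟩, rfl⟩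
  have h' : (fun x : ℂ × ℝ => rotY x.2 (embedPlane x.1)) '' (A ×ˢ Icc 0 (2 * Real.pi)) ⊆
      revolve A := by
    rintro _ ⟨⟨z, φ⟩, ⟨hz, hφ⟩, rfl⟩
    rcases hφ.2.lt_or_eq with h | h
    · exact ⟨z, hz, φ, ⟨hφ.1, h⟩, rfl⟩
    · refine ⟨z, hz, 0, ⟨le_rfl, Real.two_pi_pos⟩, ?_⟩
      change φ = 2 * Real.pi at h
      simp [h, rotY]
  rw [h.antisymm h']
  exact (hA.prod isCompact_Icc).image continuous_rotY_embedPlane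

/-! ### Fourier expansion of the circle mean -/

theorem integral_angleMeasure {E : Type*} [NormedAddCommGroup E] [NormedSpace ℝ E] (f : ℝ → E) :
    ∫ φ, f φ ∂angleMeasure = (2 * Real.pi)⁻¹ • ∫ φ in (0 : ℝ)..(2 * Real.pi), f φ := by
  rw [angleMeasure, integral_smul_measure, intervalIntegral.integral_of_le Real.two_pi_pos.le,
    integral_Ico_eq_integral_Ioc, ENNReal.toReal_inv, ENNReal.toReal_ofReal Real.two_pi_pos.le]

theorem integral_exp_int_mul_angleMeasure (k : ℤ) :
    ∫ φ : ℝ, Complex.exp (k * Complex.I * φ) ∂angleMeasure = if k = 0 then 1 else 0 := by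
  split_ifs with h
  · simp [h]
  · rw [integral_angleMeasure, integral_exp_mul_complex
      (mul_ne_zero (by exact_mod_cast h) Complex.I_ne_zero)]
    have h1 : Complex.exp (k * Complex.I * ((2 * Real.pi : ℝ) : ℂ)) = 1 := by
      rw [← Complex.exp_int_mul_two_pi_mul_I k]
      congr 1; push_cast; ring
    rw [h1]
    simp

/-- Parseval's identity for absolutely convergent Fourier series supported on `ℕ`. -/
theorem hasSum_norm_sq_angleMeasure {d : ℕ → ℂ} (hd : Summable fun n => ‖d n‖) :
    HasSum (fun n => ‖d n‖ ^ 2)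
      (∫ φ : ℝ, ‖∑' n, d n * Complex.exp (φ * Complex.I) ^ n‖ ^ 2 ∂angleMeasure) := by
  -- These are the terms of the series times its conjugate; orthogonality of the exponentials leaves
  -- only the diagonal.
  let F : ℕ × ℕ → ℝ → ℂ := fun x φ =>
    d x.1 * (starRingEnd ℂ) (d x.2) * Complex.exp (((x.1 : ℤ) - (x.2 : ℤ) : ℤ) * Complex.I * φ)
  have hnorm : ∀ x φ, ‖F x φ‖ = ‖d x.1‖ * ‖d x.2‖ := by
    intro x φ
    simp only [F, norm_mul, RCLike.norm_conj]
    rw [show ((((x.1 : ℤ) - (x.2 : ℤ) : ℤ) : ℂ) * Complex.I * φ) =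
      ((((x.1 : ℤ) - (x.2 : ℤ) : ℤ) * φ : ℝ) : ℂ) * Complex.I by push_cast; ring,
      Complex.norm_exp_ofReal_mul_I, mul_one]
  have hsum2 : Summable fun x : ℕ × ℕ => ‖d x.1‖ * ‖d x.2‖ :=
    hd.mul_of_nonneg hd (fun _ => norm_nonneg _) (fun _ => norm_nonneg _)
  have hFi : ∀ x, Integrable (F x) angleMeasure := fun x =>
    Integrable.of_bound (by fun_prop) (‖d x.1‖ * ‖d x.2‖)
      (Filter.Eventually.of_forall fun φ => (hnorm x φ).le)
  have h1 := hasSum_integral_of_summable_integral_norm hFi (by simpa [hnorm] using hsum2)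
  have h2 : ∀ φ : ℝ, ∑' x, F x φ =
      ((‖∑' n, d n * Complex.exp (φ * Complex.I) ^ n‖ ^ 2 : ℝ) : ℂ) := by
    intro φ
    have hs : Summable fun n => ‖d n * Complex.exp (φ * Complex.I) ^ n‖ := by
      simpa [Complex.norm_exp_ofReal_mul_I] using hd
    have hs' : Summable fun n => ‖(starRingEnd ℂ) (d n * Complex.exp (φ * Complex.I) ^ n)‖ := by
      simpa only [RCLike.norm_conj] using hs
    push_cast
    rw [← Complex.mul_conj', Complex.conj_tsum, tsum_mul_tsum_of_summable_norm hs hs']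
    refine tsum_congr fun x => ?_
    simp only [F, map_mul, map_pow, ← Complex.exp_conj, Complex.conj_ofReal, Complex.conj_I]
    rw [show (((x.1 : ℤ) - (x.2 : ℤ) : ℤ) : ℂ) * Complex.I * φ =
      (x.1 : ℂ) * (φ * Complex.I) + (x.2 : ℂ) * (φ * -Complex.I) by push_cast; ring,
      Complex.exp_add, Complex.exp_nat_mul, Complex.exp_nat_mul]
    ring
  have h3 : ∀ x, ∫ φ, F x φ ∂angleMeasure =
      if x.1 = x.2 then ((‖d x.1‖ ^ 2 : ℝ) : ℂ) else 0 := by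
    intro x
    simp only [F]
    rw [integral_const_mul, integral_exp_int_mul_angleMeasure]
    by_cases h : x.1 = x.2
    · simp [h, Complex.mul_conj']
    · have : (x.1 : ℤ) - x.2 ≠ 0 := by omega
      simp [h, this]
  simp_rw [h2, h3] at h1
  rw [integral_complex_ofReal] at h1
  have h4 : HasSum (fun n => ((‖d n‖ ^ 2 : ℝ) : ℂ))
      ((∫ φ : ℝ, ‖∑' n, d n * Complex.exp (φ * Complex.I) ^ n‖ ^ 2 ∂angleMeasure : ℝ) : ℂ) := by
    have hinj : Function.Injective fun n : ℕ => (n, n) := fun a b h => (Prod.ext_iff.1 h).1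
    rw [← hinj.hasSum_iff] at h1
    · simpa [Function.comp_def] using h1
    · rintro ⟨a, b⟩ hx
      rw [if_neg]
      intro h
      exact hx ⟨a, Prod.ext rfl h⟩
  exact_mod_cast h4

/-- The mean of `|1 - r e^{iφ}|⁻ˢ` over the unit circle. -/
def circleMean (s r : ℝ) : ℝ≥0∞ :=
  ∫⁻ φ : ℝ, ‖(1 - r * Complex.exp (φ * Complex.I) : ℂ)‖ₑ ^ (-s) ∂angleMeasure

/-- The coefficients of the expansion of `circleMean s` in powers of `r²`. -/
def circleCoeff (s : ℝ) (n : ℕ) : ℝ := ‖Ring.choose (((s / 2 : ℝ) : ℂ) + n - 1) n‖ ^ 2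

theorem circleCoeff_nonneg (s : ℝ) (n : ℕ) : 0 ≤ circleCoeff s n := sq_nonneg _

theorem circleCoeff_one_pos {s : ℝ} (hs : 0 < s) : 0 < circleCoeff s 1 := by
  have h : Ring.choose (((s / 2 : ℝ) : ℂ) + (1 : ℕ) - 1) 1 = ((s / 2 : ℝ) : ℂ) := by
    rw [Ring.choose_one_right]; simp
  rw [circleCoeff, h, Complex.norm_real, Real.norm_of_nonneg (by positivity)]
  positivity

/-- The integrand is the squared modulus of `(1 - r e^{iφ})^{-s/2}`, whose binomial series converges
absolutely for `r < 1`. Parseval's identity then sums the squared coefficients. -/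
theorem circleMean_eq_tsum (s : ℝ) {r : ℝ} (hr0 : 0 ≤ r) (hr1 : r < 1) :
    circleMean s r = ∑' n, ENNReal.ofReal (circleCoeff s n * r ^ (2 * n)) := by
  let c : ℕ → ℂ := fun n => Ring.choose (((s / 2 : ℝ) : ℂ) + n - 1) n
  have hps := Complex.one_div_one_sub_cpow_hasFPowerSeriesOnBall_zero ((s / 2 : ℝ) : ℂ)
  have hd : Summable fun n => ‖c n * (r : ℂ) ^ n‖ := by
    have hlt : ENNReal.ofNNReal ⟨r, hr0⟩ <
        (FormalMultilinearSeries.ofScalars ℂ c).radius := by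
      exact lt_of_lt_of_le (ENNReal.coe_lt_one_iff.2 hr1) hps.r_le
    refine ((FormalMultilinearSeries.ofScalars ℂ c).summable_norm_mul_pow hlt).of_nonneg_of_le
      (fun _ => norm_nonneg _) fun n => ?_
    rw [norm_mul, norm_pow, Complex.norm_real, Real.norm_of_nonneg hr0,
      FormalMultilinearSeries.ofScalars_norm]
    rfl
  have hfun : ∀ φ : ℝ, ∑' n, c n * (r : ℂ) ^ n * Complex.exp (φ * Complex.I) ^ n =
      1 / (1 - r * Complex.exp (φ * Complex.I)) ^ (((s / 2 : ℝ)) : ℂ) := by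
    intro φ
    have hmem : (r * Complex.exp (φ * Complex.I) : ℂ) ∈ Metric.eball (0 : ℂ) 1 := by
      have h1 : ‖(r * Complex.exp (φ * Complex.I) : ℂ)‖ < 1 := by
        rw [norm_mul, Complex.norm_exp_ofReal_mul_I, Complex.norm_real, mul_one,
          Real.norm_of_nonneg hr0]
        exact hr1
      rw [← ENNReal.ofReal_one, Metric.eball_ofReal]
      simpa using h1
    have h2 := (hps.hasSum hmem).tsum_eq
    rw [zero_add] at h2
    rw [← h2]
    refine tsum_congr fun n => ?_
    rw [FormalMultilinearSeries.ofScalars_apply_eq, smul_eq_mul, mul_pow, mul_assoc]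
  have hne : ∀ φ : ℝ, 0 < ‖(1 - r * Complex.exp (φ * Complex.I) : ℂ)‖ := by
    intro φ
    rw [norm_pos_iff, sub_ne_zero]
    intro h
    have := congrArg norm h
    rw [norm_mul, Complex.norm_exp_ofReal_mul_I, Complex.norm_real, mul_one,
      Real.norm_of_nonneg hr0, norm_one] at this
    exact hr1.ne this.symm
  have hsq : ∀ φ : ℝ, ‖∑' n, c n * (r : ℂ) ^ n * Complex.exp (φ * Complex.I) ^ n‖ ^ 2 =
      ‖(1 - r * Complex.exp (φ * Complex.I) : ℂ)‖ ^ (-s) := by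
    intro φ
    rw [hfun, norm_div, norm_one, Complex.norm_cpow_real, one_div, ← Real.rpow_neg (hne φ).le,
      ← Real.rpow_natCast, ← Real.rpow_mul (hne φ).le]
    congr 1; push_cast; ring
  have hP := hasSum_norm_sq_angleMeasure hd
  simp_rw [hsq] at hP
  have hcont : Continuous fun φ : ℝ => ‖(1 - r * Complex.exp (φ * Complex.I) : ℂ)‖ ^ (-s) := by
    refine Continuous.rpow_const (by fun_prop) fun φ => Or.inl (hne φ).ne'
  have hint : Integrable (fun φ : ℝ => ‖(1 - r * Complex.exp (φ * Complex.I) : ℂ)‖ ^ (-s))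
      angleMeasure := by
    have h1 : IntegrableOn (fun φ : ℝ => ‖(1 - r * Complex.exp (φ * Complex.I) : ℂ)‖ ^ (-s))
        (Ico 0 (2 * Real.pi)) :=
      (hcont.continuousOn.integrableOn_compact isCompact_Icc).mono_set Ico_subset_Icc_self
    exact h1.smul_measure (by simpa using Real.pi_pos)
  have hterm : ∀ n, ‖c n * (r : ℂ) ^ n‖ ^ 2 = circleCoeff s n * r ^ (2 * n) := by
    intro n
    rw [norm_mul, norm_pow, Complex.norm_real, Real.norm_of_nonneg hr0, mul_pow, ← pow_mul,
      mul_comm n, circleCoeff]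
  simp_rw [hterm] at hP
  rw [← ENNReal.ofReal_tsum_of_nonneg
    (fun n => mul_nonneg (circleCoeff_nonneg s n) (by positivity)) hP.summable, hP.tsum_eq,
    ofReal_integral_eq_lintegral_ofReal hint
      (Filter.Eventually.of_forall fun φ => Real.rpow_nonneg (norm_nonneg _) _), circleMean]
  refine lintegral_congr fun φ => ?_
  rw [← ofReal_norm, ENNReal.ofReal_rpow_of_pos (hne φ)]

theorem norm_one_sub_mul_exp_sq (r φ : ℝ) :
    ‖(1 - r * Complex.exp (φ * Complex.I) : ℂ)‖ ^ 2 = 1 + r ^ 2 - 2 * r * Real.cos φ := by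
  rw [Complex.sq_norm, Complex.normSq_apply]
  simp only [Complex.sub_re, Complex.one_re, Complex.mul_re, Complex.ofReal_re, Complex.ofReal_im,
    Complex.exp_ofReal_mul_I_re, Complex.exp_ofReal_mul_I_im, Complex.sub_im, Complex.one_im,
    Complex.mul_im]
  linear_combination r ^ 2 * Real.sin_sq_add_cos_sq φ

/-- Finiteness of the energy of a circle for `s < 1`. -/
theorem circleMean_one_ne_top {s : ℝ} (hs0 : 0 < s) (hs1 : s < 1) : circleMean s 1 ≠ ∞ := by
  have hπ := Real.pi_pos
  -- Jordan's inequality for `sin (x / 2)`: the chord `|1 - e^{ix}|` is at least `2x/π`, so its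
  -- power `-s` is integrable at `0` when `s < 1`.
  have hlow : ∀ x : ℝ, 0 < x → x ≤ Real.pi →
      (2 / Real.pi * x) ^ 2 ≤ 2 - 2 * Real.cos x := by
    intro x hx0 hx
    have h1 := Real.mul_le_sin (x := x / 2) (by linarith) (by linarith)
    have h2 : Real.cos x = 1 - 2 * Real.sin (x / 2) ^ 2 := by
      have h3 := Real.cos_two_mul (x / 2)
      have h4 := Real.sin_sq_add_cos_sq (x / 2)
      rw [show 2 * (x / 2) = x by ring] at h3
      linarith
    have h3 : 0 ≤ 2 / Real.pi * (x / 2) := by positivity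
    have h4 : (2 / Real.pi * (x / 2)) ^ 2 ≤ Real.sin (x / 2) ^ 2 := pow_le_pow_left₀ h3 h1 2
    rw [h2]
    nlinarith
  have hbd : ∀ x φ : ℝ, 0 < x → x ≤ Real.pi → Real.cos x = Real.cos φ →
      ‖(1 - (1 : ℝ) * Complex.exp (φ * Complex.I) : ℂ)‖ₑ ^ (-s) ≤
        ENNReal.ofReal ((2 / Real.pi) ^ (-s) * x ^ (-s)) := by
    intro x φ hx0 hx hc
    have h1 := hlow x hx0 hx
    have h2 := norm_one_sub_mul_exp_sq 1 φ
    have h3 : 2 / Real.pi * x ≤ ‖(1 - (1 : ℝ) * Complex.exp (φ * Complex.I) : ℂ)‖ := by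
      refine le_of_sq_le_sq ?_ (norm_nonneg _)
      rw [h2, ← hc]
      linarith
    have h4 : 0 < 2 / Real.pi * x := by positivity
    rw [← Real.mul_rpow (by positivity) hx0.le, ← ENNReal.ofReal_rpow_of_pos h4, ← ofReal_norm,
      ENNReal.rpow_neg, ENNReal.rpow_neg]
    exact ENNReal.inv_le_inv.2 (ENNReal.rpow_le_rpow (ENNReal.ofReal_le_ofReal h3) hs0.le)
  have hi1 : IntegrableOn (fun x : ℝ => (2 / Real.pi) ^ (-s) * x ^ (-s))
      (Ioc 0 (2 * Real.pi)) := by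
    rw [← intervalIntegrable_iff_integrableOn_Ioc_of_le Real.two_pi_pos.le]
    exact (intervalIntegral.intervalIntegrable_rpow' (by linarith)).const_mul _
  have hi2 : IntegrableOn (fun x : ℝ => (2 / Real.pi) ^ (-s) * (2 * Real.pi - x) ^ (-s))
      (Ioc 0 (2 * Real.pi)) := by
    rw [← intervalIntegrable_iff_integrableOn_Ioc_of_le Real.two_pi_pos.le]
    have h := (intervalIntegral.intervalIntegrable_rpow' (a := 0) (b := 2 * Real.pi)
      (r := -s) (by linarith)).comp_sub_left (2 * Real.pi)
    rw [sub_zero, sub_self] at h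
    exact h.symm.const_mul _
  rw [circleMean, lintegral_angleMeasure]
  refine ENNReal.mul_ne_top (by simpa using hπ) ?_
  rw [setLIntegral_congr Ico_ae_eq_Ioc]
  -- The singularity sits at both ends of the period; the two terms control the halves on either
  -- side of `π`.
  have hle : ∀ᵐ φ : ℝ ∂(volume.restrict (Ioc 0 (2 * Real.pi))),
      ‖(1 - (1 : ℝ) * Complex.exp (φ * Complex.I) : ℂ)‖ₑ ^ (-s) ≤
        ENNReal.ofReal ((2 / Real.pi) ^ (-s) * φ ^ (-s)) +
        ENNReal.ofReal ((2 / Real.pi) ^ (-s) * (2 * Real.pi - φ) ^ (-s)) := by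
    have hne : ∀ᵐ φ : ℝ ∂(volume.restrict (Ioc 0 (2 * Real.pi))), φ ≠ 2 * Real.pi :=
      ae_restrict_of_ae (measure_eq_zero_iff_ae_notMem.1 Real.volume_singleton)
    filter_upwards [self_mem_ae_restrict measurableSet_Ioc, hne] with φ hφ hφ2
    rcases le_or_gt φ Real.pi with h | h
    · exact (hbd φ φ hφ.1 h rfl).trans le_self_add
    · refine (hbd (2 * Real.pi - φ) φ ?_ (by linarith) ?_).trans le_add_self
      · exact sub_pos.2 (lt_of_le_of_ne hφ.2 hφ2)
      · rw [Real.cos_two_pi_sub]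
  refine ne_top_of_le_ne_top ?_ (lintegral_mono_ae hle)
  rw [lintegral_add_left (by fun_prop)]
  have hnn : ∀ f : ℝ → ℝ, IntegrableOn f (Ioc 0 (2 * Real.pi)) →
      ∫⁻ x in Ioc 0 (2 * Real.pi), ENNReal.ofReal (f x) ≠ ∞ := by
    intro f hf
    refine ne_top_of_le_ne_top hf.2.ne (lintegral_mono fun x => ?_)
    exact Real.ofReal_le_enorm _
  exact ENNReal.add_ne_top.2 ⟨hnn _ hi1, hnn _ hi2⟩

/-- Pointwise, `|1 - r e^{iφ}|² - r |1 - e^{iφ}|² = (1 - r)² ≥ 0`. This bounds the means for `r < 1`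
by the mean at `1`, with a factor tending to `1`. -/
theorem circleMean_mul_rpow_le {s r : ℝ} (hs0 : 0 < s) (hr0 : 0 < r) :
    circleMean s r * ENNReal.ofReal (r ^ (s / 2)) ≤ circleMean s 1 := by
  rw [circleMean, circleMean, mul_comm, ← lintegral_const_mul' _ _ ENNReal.ofReal_ne_top]
  refine lintegral_mono fun φ => ?_
  simp only
  have h1 := norm_one_sub_mul_exp_sq r φ
  have h2 := norm_one_sub_mul_exp_sq 1 φ
  set a := ‖(1 - r * Complex.exp (φ * Complex.I) : ℂ)‖
  set b := ‖(1 - (1 : ℝ) * Complex.exp (φ * Complex.I) : ℂ)‖ with hb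
  have h3 : √r * b ≤ a := by
    refine le_of_sq_le_sq ?_ (norm_nonneg _)
    rw [mul_pow, Real.sq_sqrt hr0.le, h1, h2]
    nlinarith [sq_nonneg (1 - r)]
  have h4 : ENNReal.ofReal (r ^ (s / 2)) = (ENNReal.ofReal (√r) ^ (-s))⁻¹ := by
    rw [← ENNReal.rpow_neg, neg_neg, ENNReal.ofReal_rpow_of_pos (Real.sqrt_pos.2 hr0),
      Real.sqrt_eq_rpow, ← Real.rpow_mul hr0.le]
    congr 2; ring
  rw [← ofReal_norm, ← ofReal_norm, h4]
  have h5 : ENNReal.ofReal a ^ (-s) ≤ (ENNReal.ofReal √r * ENNReal.ofReal b) ^ (-s) := by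
    rw [ENNReal.rpow_neg, ENNReal.rpow_neg, ← ENNReal.ofReal_mul (Real.sqrt_nonneg r)]
    exact ENNReal.inv_le_inv.2 (ENNReal.rpow_le_rpow (ENNReal.ofReal_le_ofReal h3) hs0.le)
  have h6 : ENNReal.ofReal √r ≠ 0 := by simpa using hr0
  rw [mul_comm, ← div_eq_mul_inv]
  refine ENNReal.div_le_of_le_mul (h5.trans ?_)
  rw [ENNReal.mul_rpow_of_ne_top ENNReal.ofReal_ne_top ENNReal.ofReal_ne_top, mul_comm]

/-- Let `r` increase to `1` in each partial sum. Only this inequality is needed at `r = 1`, because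
the strict comparisons expand the kernel exactly only off the diagonal. -/
theorem tsum_circleCoeff_le {s : ℝ} (hs0 : 0 < s) :
    ∑' n, ENNReal.ofReal (circleCoeff s n) ≤ circleMean s 1 := by
  rw [ENNReal.tsum_eq_iSup_nat]
  refine iSup_le fun N => ?_
  have hlim : Filter.Tendsto (fun r : ℝ => ENNReal.ofReal
      ((∑ n ∈ Finset.range N, circleCoeff s n * r ^ (2 * n)) * r ^ (s / 2)))
      (nhdsWithin 1 (Iio 1)) (nhds (∑ n ∈ Finset.range N, ENNReal.ofReal (circleCoeff s n))) := by
    have hc : ContinuousAt (fun r : ℝ => ENNReal.ofReal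
      ((∑ n ∈ Finset.range N, circleCoeff s n * r ^ (2 * n)) * r ^ (s / 2))) 1 := by
      refine ENNReal.continuous_ofReal.continuousAt.comp ?_
      refine ContinuousAt.mul (by fun_prop) ?_
      exact Real.continuousAt_rpow_const _ _ (Or.inl one_ne_zero)
    have h := hc.tendsto
    simp only [one_pow, mul_one, Real.one_rpow] at h
    rw [ENNReal.ofReal_sum_of_nonneg fun n _ => circleCoeff_nonneg s n] at h
    exact h.mono_left nhdsWithin_le_nhds
  refine le_of_tendsto hlim ?_
  filter_upwards [Ioo_mem_nhdsLT (zero_lt_one' ℝ)] with r hr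
  rw [ENNReal.ofReal_mul (Finset.sum_nonneg fun n _ =>
    mul_nonneg (circleCoeff_nonneg s n) (pow_nonneg hr.1.le _)),
    ENNReal.ofReal_sum_of_nonneg fun n _ =>
    mul_nonneg (circleCoeff_nonneg s n) (pow_nonneg hr.1.le _)]
  refine le_trans ?_ (circleMean_mul_rpow_le hs0 hr.1)
  rw [circleMean_eq_tsum s hr.1.le hr.2]
  gcongr
  exact ENNReal.sum_le_tsum _

/-- The hypotheses match the coefficients of `1` and `cos φ` in `|R_φ z - w|² = c² |1 - r e^{iφ}|²`.
-/
theorem axialKernel_eq_circleMean (s : ℝ) {z w : ℂ} {c r : ℝ} (hc : 0 < c)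
    (h1 : c ^ 2 * (1 + r ^ 2) = z.re ^ 2 + w.re ^ 2 + (z.im - w.im) ^ 2)
    (h2 : c ^ 2 * r = z.re * w.re) :
    axialKernel s z w = ENNReal.ofReal (c ^ (-s)) * circleMean s r := by
  rw [axialKernel_eq, circleMean, ← lintegral_const_mul' _ _ ENNReal.ofReal_ne_top]
  refine lintegral_congr fun φ => ?_
  have h3 : dist (rotY φ (embedPlane z)) (embedPlane w) =
      c * ‖(1 - r * Complex.exp (φ * Complex.I) : ℂ)‖ := by
    rw [EuclideanSpace.dist_eq, Real.sqrt_eq_iff_mul_self_eq (by positivity) (by positivity)]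
    have h4 := norm_one_sub_mul_exp_sq r φ
    simp only [Fin.sum_univ_three, Real.dist_eq, sq_abs]
    simp only [rotY, embedPlane, PiLp.toLp_apply, Matrix.cons_val]
    linear_combination z.re ^ 2 * Real.sin_sq_add_cos_sq φ - c ^ 2 * h4 - h1 +
      2 * Real.cos φ * h2
  rw [rieszKernel, edist_dist, h3, ENNReal.ofReal_mul hc.le, ofReal_norm,
    ENNReal.mul_rpow_of_ne_top ENNReal.ofReal_ne_top enorm_ne_top,
    ENNReal.ofReal_rpow_of_pos hc]

/-! ### Potentials and supports of equilibrium measures -/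

open Filter Topology in
-- Fatou's lemma along convergent sequences: potentials are lower semicontinuous. Closed sublevel
-- sets carry an almost-everywhere bound over to the whole support.
theorem isClosed_setOf_lintegral_le {X Y : Type*} [TopologicalSpace X] [SequentialSpace X]
    [MeasurableSpace Y] (μ : Measure Y) {f : X → Y → ℝ≥0∞} (hf : ∀ y, Continuous fun x => f x y)
    (hm : ∀ x, Measurable (f x)) (c : ℝ≥0∞) : IsClosed {x | ∫⁻ y, f x y ∂μ ≤ c} := by
  refine IsSeqClosed.isClosed fun u x hu hx => ?_
  calc ∫⁻ y, f x y ∂μ = ∫⁻ y, liminf (fun n => f (u n) y) atTop ∂μ :=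
        lintegral_congr fun y => (((hf y).tendsto x).comp hx).liminf_eq.symm
    _ ≤ liminf (fun n => ∫⁻ y, f (u n) y ∂μ) atTop := lintegral_liminf_le fun n => hm _
    _ ≤ c := liminf_le_of_frequently_le' (Frequently.of_forall hu)

section Frostman

variable {X : Type*} [MeasurableSpace X] {k : X → X → ℝ≥0∞} {K : Set X} {μ : Measure X}

/-- The potential of an equilibrium measure is at least the minimal energy at every point where
the kernel is finite on the diagonal. -/
theorem IsEquilibriumMeasure.kernelEnergy_le_potential [MeasurableSingletonClass X]
    (hk : Measurable (Function.uncurry k))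
    (hsymm : ∀ x y, k x y = k y x) (hμ : IsEquilibriumMeasure k K μ)
    (hfin : kernelEnergy k μ ≠ ∞) {x : X} (hx : x ∈ K) (hxx : k x x ≠ ∞) :
    kernelEnergy k μ ≤ ∫⁻ y, k x y ∂μ := by
  have := hμ.isProbabilityMeasure
  by_contra! hlt
  have hU : mutualEnergy k μ (Measure.dirac x) = ∫⁻ y, k x y ∂μ := by
    rw [mutualEnergy_comm hk hsymm, mutualEnergy, lintegral_dirac]
  have hd : kernelEnergy k (Measure.dirac x) = k x x := by
    rw [kernelEnergy, lintegral_dirac, lintegral_dirac]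
  have hUfin : ∫⁻ y, k x y ∂μ ≠ ∞ := ne_top_of_lt hlt
  -- The competitor is `(1 - ε) μ + ε δₓ`, whose energy is finite because the kernel is finite at
  -- `(x, x)`.
  have hmin : ∀ ε : ℝ, 0 < ε → ε < 1 → kernelEnergy k μ ≤ ENNReal.ofReal (1 - ε) *
      (ENNReal.ofReal (1 - ε) * kernelEnergy k μ) + 2 * (ENNReal.ofReal (1 - ε) *
      (ENNReal.ofReal ε * ∫⁻ y, k x y ∂μ)) + ENNReal.ofReal ε * (ENNReal.ofReal ε * k x x) := by
    intro ε h0 h1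
    rw [← hU, ← hd, ← kernelEnergy_add_smul hk hsymm]
    refine hμ.energy_le _ ⟨?_⟩ ?_
    · simp [← ENNReal.ofReal_add (sub_nonneg.2 h1.le) h0.le]
    · simp [hμ.measure_compl, hx]
  generalize kernelEnergy k μ = W at *
  generalize ∫⁻ y, k x y ∂μ = U at *
  generalize k x x = d at *
  lift W to NNReal using hfin
  lift U to NNReal using hUfin
  lift d to NNReal using hxx
  have hlt' : (U : ℝ) < W := by exact_mod_cast hlt
  have hreal : ∀ ε : ℝ, 0 < ε → ε < 1 →
      (W : ℝ) ≤ (1 - ε) * ((1 - ε) * W) + 2 * ((1 - ε) * (ε * U)) + ε * (ε * d) := by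
    intro ε h0 h1
    have h2 : (0 : ℝ) ≤ 1 - ε := by linarith
    have h := hmin ε h0 h1
    have hr := ENNReal.toReal_mono (by finiteness) h
    rw [ENNReal.toReal_add (by finiteness) (by finiteness),
      ENNReal.toReal_add (by finiteness) (by finiteness)] at hr
    simpa [ENNReal.toReal_mul, ENNReal.toReal_ofReal h2, ENNReal.toReal_ofReal h0.le] using hr
  -- Minimality reads `0 ≤ ε (-2 (W - U) + ε m)`. The choice of `ε` below makes `ε m ≤ W - U`, which
  -- contradicts `U < W`.
  set m : ℝ := W - 2 * U + d with hm
  have hδ : 0 < ((W : ℝ) - U) / (|m| + 1) := div_pos (by linarith) (by positivity)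
  set ε := min (1 / 2) (((W : ℝ) - U) / (|m| + 1)) with hε
  have hε0 : 0 < ε := lt_min (by norm_num) hδ
  have hε1 : ε < 1 := lt_of_le_of_lt (min_le_left _ _) (by norm_num)
  have h1 := hreal ε hε0 hε1
  have h2 : ε * (|m| + 1) ≤ W - U := by
    rw [← le_div_iff₀ (by positivity)]
    exact min_le_right _ _
  have h3 : ε * m ≤ ε * (|m| + 1) :=
    mul_le_mul_of_nonneg_left (by linarith [le_abs_self m]) hε0.le
  have h4 : 0 ≤ ε * (-2 * (W - U) + ε * m) := by rw [hm]; nlinarith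
  have h5 := (mul_nonneg_iff_of_pos_left hε0).1 h4
  linarith

/-- The potential of an equilibrium measure equals the minimal energy on the support. -/
theorem IsEquilibriumMeasure.potential_eq_kernelEnergy [MeasurableSingletonClass X]
    [TopologicalSpace X] (hk : Measurable (Function.uncurry k))
    (hsymm : ∀ x y, k x y = k y x) (hμ : IsEquilibriumMeasure k K μ)
    (hfin : kernelEnergy k μ ≠ ∞) (hdiag : ∀ x ∈ K, k x x ≠ ∞)
    (hclosed : ∀ c, IsClosed {x | ∫⁻ y, k x y ∂μ ≤ c}) {x : X} (hx : x ∈ K)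
    (hxs : x ∈ μ.support) : ∫⁻ y, k x y ∂μ = kernelEnergy k μ := by
  have := hμ.isProbabilityMeasure
  have hle : ∀ᵐ x ∂μ, kernelEnergy k μ ≤ ∫⁻ y, k x y ∂μ := by
    have hK : ∀ᵐ x ∂μ, x ∈ K := hμ.measure_compl
    filter_upwards [hK] with x hx
    exact hμ.kernelEnergy_le_potential hk hsymm hfin hx (hdiag x hx)
  have hae : ∀ᵐ x ∂μ, ∫⁻ y, k x y ∂μ ≤ kernelEnergy k μ := by
    -- The potential is at least `W` almost everywhere and its integral is `W`, so it equals `W`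
    -- almost everywhere.
    have h := ae_eq_of_ae_le_of_lintegral_le hle (by simpa using hfin)
      hk.lintegral_prod_right.aemeasurable (by simp [kernelEnergy])
    filter_upwards [h] with x hx
    exact hx.ge
  refine le_antisymm ?_ (hμ.kernelEnergy_le_potential hk hsymm hfin hx (hdiag x hx))
  exact Measure.support_subset_of_isClosed (hclosed _) hae hxs

end Frostman

/-- A set on which the kernel, read in the coordinate `π`, is strictly convex and strictly
decreasing away from the diagonal is the support of its equilibrium measure. -/
theorem IsEquilibriumMeasure.support_eq_of_strictConvex {X : Type*} [MeasurableSpace X]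
    [TopologicalSpace X] [HereditarilyLindelofSpace X] [MeasurableSingletonClass X] [T2Space X]
    {k : X → X → ℝ≥0∞} (hk : Measurable (Function.uncurry k)) (hsymm : ∀ x y, k x y = k y x)
    {A : Set X} (hA : IsCompact A) {μ : Measure X} (hμ : IsEquilibriumMeasure k A μ)
    (hfin : kernelEnergy k μ ≠ ∞) (hdiag : ∀ x ∈ A, k x x ≠ ∞)
    (hclosed : ∀ c, IsClosed {x | ∫⁻ y, k x y ∂μ ≤ c})
    {π : X → ℝ} (hπ : Continuous π) (hinj : InjOn π A)
    (hconv : ∀ y ∈ A, ∀ x₀ ∈ A, ∀ x₁ ∈ A, ∀ x₂ ∈ A, ∀ t u : ℝ, 0 < t → 0 < u → t + u = 1 →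
      π x₀ = t * π x₁ + u * π x₂ → π x₁ < π x₂ → (π y ≤ π x₁ ∨ π x₂ ≤ π y) →
      k x₀ y < ENNReal.ofReal t * k x₁ y + ENNReal.ofReal u * k x₂ y)
    (hright : ∀ y ∈ A, ∀ x₀ ∈ A, ∀ x₁ ∈ A, π y ≤ π x₁ → π x₁ < π x₀ → k x₀ y < k x₁ y)
    (hleft : ∀ y ∈ A, ∀ x₀ ∈ A, ∀ x₂ ∈ A, π x₂ ≤ π y → π x₀ < π x₂ → k x₀ y < k x₂ y) :
    μ.support = A := by
  have := hμ.isProbabilityMeasure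
  have hsub : μ.support ⊆ A := Measure.support_subset_of_isClosed hA.isClosed hμ.measure_compl
  refine hsub.antisymm fun x₀ hx₀ => ?_
  by_contra hx₀s
  have hS : IsCompact μ.support := hA.of_isClosed_subset Measure.isClosed_support hsub
  have hW : kernelEnergy k μ ≤ ∫⁻ y, k x₀ y ∂μ :=
    hμ.kernelEnergy_le_potential hk hsymm hfin hx₀ (hdiag x₀ hx₀)
  have hpot : ∀ x ∈ μ.support, ∫⁻ y, k x y ∂μ = kernelEnergy k μ := fun x hx =>
    hμ.potential_eq_kernelEnergy hk hsymm hfin hdiag hclosed (hsub hx) hx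
  have hmeas : ∀ x, Measurable (k x) := fun x => hk.comp measurable_prodMk_left
  have hae : ∀ᵐ y ∂μ, y ∈ μ.support := Measure.support_mem_ae
  -- Any majorant of `k x₀`, strict on the support and with integral `W`, would force the potential
  -- at `x₀` below `W`.
  have hcontra : ∀ g : X → ℝ≥0∞, Measurable g → (∀ y ∈ μ.support, k x₀ y < g y) →
      ∫⁻ y, g y ∂μ = kernelEnergy k μ → False := by
    intro g hg hlt hgW
    have hae' : ∀ᵐ y ∂μ, k x₀ y < g y := hae.mono hlt
    have h0 : ∫⁻ y, k x₀ y ∂μ ≠ ∞ := ne_top_of_le_ne_top (hgW ▸ hfin)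
      (lintegral_mono_ae (hae'.mono fun _ h => h.le))
    have h1 := lintegral_strict_mono (IsProbabilityMeasure.ne_zero μ) hg.aemeasurable h0 hae'
    exact (hgW ▸ h1).not_ge hW
  have hT : IsCompact (π '' μ.support) := hS.image hπ
  have hTne : (π '' μ.support).Nonempty :=
    (Measure.nonempty_support (IsProbabilityMeasure.ne_zero μ)).image π
  have hne : ∀ x ∈ μ.support, π x ≠ π x₀ := fun x hx h =>
    hx₀s (hinj (hsub hx) hx₀ h ▸ hx)
  -- Compactness of the support provides a nearest support point on the left of `x₀`, unless there
  -- is none; likewise on the right. No support point lies strictly between these neighbours.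
  have hL : (∀ x ∈ μ.support, π x₀ < π x) ∨ ∃ x₁ ∈ μ.support, π x₁ < π x₀ ∧
      ∀ y ∈ μ.support, π y < π x₀ → π y ≤ π x₁ := by
    by_cases h : (π '' μ.support ∩ Iic (π x₀)).Nonempty
    · obtain ⟨_, ⟨⟨x₁, hx₁, rfl⟩, hle⟩, hmax⟩ :=
        (hT.inter_right isClosed_Iic).exists_isGreatest h
      exact Or.inr ⟨x₁, hx₁, lt_of_le_of_ne hle (hne x₁ hx₁), fun y hy hy' =>
        hmax ⟨⟨y, hy, rfl⟩, hy'.le⟩⟩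
    · exact Or.inl fun x hx => not_le.1 fun hle => h ⟨_, ⟨x, hx, rfl⟩, hle⟩
  have hR : (∀ x ∈ μ.support, π x < π x₀) ∨ ∃ x₂ ∈ μ.support, π x₀ < π x₂ ∧
      ∀ y ∈ μ.support, π x₀ < π y → π x₂ ≤ π y := by
    by_cases h : (π '' μ.support ∩ Ici (π x₀)).Nonempty
    · obtain ⟨_, ⟨⟨x₂, hx₂, rfl⟩, hle⟩, hmin⟩ :=
        (hT.inter_right isClosed_Ici).exists_isLeast h
      exact Or.inr ⟨x₂, hx₂, lt_of_le_of_ne hle (hne x₂ hx₂).symm, fun y hy hy' =>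
        hmin ⟨⟨y, hy, rfl⟩, hy'.le⟩⟩
    · exact Or.inl fun x hx => not_le.1 fun hle => h ⟨_, ⟨x, hx, rfl⟩, hle⟩
  rcases hL with hL | ⟨x₁, hx₁, hlt₁, hmax⟩ <;> rcases hR with hR | ⟨x₂, hx₂, hlt₂, hmin⟩
  · obtain ⟨_, x, hx, -⟩ := hTne
    exact lt_asymm (hL x hx) (hR x hx)
  · exact hcontra (k x₂) (hmeas x₂) (fun y hy => hleft y (hsub hy) x₀ hx₀ x₂ (hsub hx₂)
      (hmin y hy (hL y hy)) hlt₂) (hpot x₂ hx₂)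
  · exact hcontra (k x₁) (hmeas x₁) (fun y hy => hright y (hsub hy) x₀ hx₀ x₁ (hsub hx₁)
      (hmax y hy (hR y hy)) hlt₁) (hpot x₁ hx₁)
  · have hd : 0 < π x₂ - π x₁ := by linarith
    set t := (π x₂ - π x₀) / (π x₂ - π x₁) with ht
    set u := (π x₀ - π x₁) / (π x₂ - π x₁) with hu
    have ht0 : 0 < t := div_pos (by linarith) hd
    have hu0 : 0 < u := div_pos (by linarith) hd
    have htu : t + u = 1 := by rw [ht, hu]; field_simp; ring
    have hx : π x₀ = t * π x₁ + u * π x₂ := by rw [ht, hu]; field_simp; ring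
    refine hcontra (fun y => ENNReal.ofReal t * k x₁ y + ENNReal.ofReal u * k x₂ y)
      (((hmeas x₁).const_mul _).add ((hmeas x₂).const_mul _)) (fun y hy => ?_) ?_
    · refine hconv y (hsub hy) x₀ hx₀ x₁ (hsub hx₁) x₂ (hsub hx₂) t u ht0 hu0 htu hx
        (hlt₁.trans hlt₂) ?_
      rcases (hne y hy).lt_or_gt with h | h
      · exact Or.inl (hmax y hy h)
      · exact Or.inr (hmin y hy h)
    · rw [lintegral_add_left ((hmeas x₁).const_mul _), lintegral_const_mul _ (hmeas x₁),
        lintegral_const_mul _ (hmeas x₂), hpot x₁ hx₁, hpot x₂ hx₂, ← add_mul,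
        ← ENNReal.ofReal_add ht0.le hu0.le, htu, ENNReal.ofReal_one, one_mul]

/-! ### Termwise comparison of series -/

/-- Strictness is asked at index `1` because on a horizontal segment with `y` on the right the term
`n = 0` is constant in `x`. -/
theorem tsum_ofReal_lt_tsum {a f g : ℕ → ℝ} (ha : ∀ n, 0 ≤ a n) (ha1 : 0 < a 1)
    (hf : ∀ n, 0 ≤ f n) (hle : ∀ n, f n ≤ g n) (hlt : f 1 < g 1)
    (hfin : ∑' n, ENNReal.ofReal (a n * f n) ≠ ∞) :
    ∑' n, ENNReal.ofReal (a n * f n) < ∑' n, ENNReal.ofReal (a n * g n) := by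
  refine ENNReal.tsum_lt_tsum (i := 1) hfin
    (fun n => ENNReal.ofReal_le_ofReal (mul_le_mul_of_nonneg_left (hle n) (ha n))) ?_
  exact (ENNReal.ofReal_lt_ofReal_iff_of_nonneg (mul_nonneg (ha 1) (hf 1))).2
    (mul_lt_mul_of_pos_left hlt ha1)

theorem tsum_ofReal_mul_add {a f g : ℕ → ℝ} (ha : ∀ n, 0 ≤ a n) (hf : ∀ n, 0 ≤ f n)
    (hg : ∀ n, 0 ≤ g n) {t u : ℝ} (ht : 0 ≤ t) (hu : 0 ≤ u) :
    ∑' n, ENNReal.ofReal (a n * (t * f n + u * g n)) =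
      ENNReal.ofReal t * ∑' n, ENNReal.ofReal (a n * f n) +
        ENNReal.ofReal u * ∑' n, ENNReal.ofReal (a n * g n) := by
  rw [← ENNReal.tsum_mul_left, ← ENNReal.tsum_mul_left, ← ENNReal.tsum_add]
  refine tsum_congr fun n => ?_
  rw [← ENNReal.ofReal_mul ht, ← ENNReal.ofReal_mul hu, ← ENNReal.ofReal_add
    (mul_nonneg ht (mul_nonneg (ha n) (hf n))) (mul_nonneg hu (mul_nonneg (ha n) (hg n)))]
  congr 1; ring

/-- The exponent `-p g` is strictly convex, and `exp` is strictly increasing and convex. It is used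
with `g = log` on horizontal segments and `g = arsinh` on vertical ones. -/
theorem exp_neg_mul_lt_of_strictConcaveOn {g : ℝ → ℝ} {S : Set ℝ} (hg : StrictConcaveOn ℝ S g)
    {p : ℝ} (hp : 0 < p) {x₁ x₂ : ℝ} (h₁ : x₁ ∈ S) (h₂ : x₂ ∈ S) (hne : x₁ ≠ x₂) {t u : ℝ}
    (ht : 0 < t) (hu : 0 < u) (htu : t + u = 1) :
    Real.exp (-p * g (t * x₁ + u * x₂)) <
      t * Real.exp (-p * g x₁) + u * Real.exp (-p * g x₂) := by
  have h1 := hg.2 h₁ h₂ hne ht hu htu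
  simp only [smul_eq_mul] at h1
  have h2 := convexOn_exp.2 (mem_univ (-p * g x₁)) (mem_univ (-p * g x₂)) ht.le hu.le htu
  simp only [smul_eq_mul] at h2
  refine lt_of_lt_of_le (Real.exp_lt_exp.2 ?_) h2
  nlinarith

theorem strictConcaveOn_arsinh : StrictConcaveOn ℝ (Ici 0) Real.arsinh := by
  refine StrictAntiOn.strictConcaveOn_of_deriv (convex_Ici 0)
    Real.continuous_arsinh.continuousOn ?_
  intro x hx y hy hxy
  rw [interior_Ici] at hx hy
  rw [(Real.hasDerivAt_arsinh x).deriv, (Real.hasDerivAt_arsinh y).deriv]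
  have hx' : 0 < x := hx
  gcongr

theorem tsum_le_circleMean {s r : ℝ} (hs : 0 < s) (hr0 : 0 ≤ r) (hr1 : r ≤ 1) :
    ∑' n, ENNReal.ofReal (circleCoeff s n * r ^ (2 * n)) ≤ circleMean s r := by
  rcases hr1.lt_or_eq with h | rfl
  · exact (circleMean_eq_tsum s hr0 h).ge
  · simpa using tsum_circleCoeff_le hs

theorem circleMean_ne_top {s r : ℝ} (hs0 : 0 < s) (hs1 : s < 1) (hr0 : 0 ≤ r) (hr1 : r ≤ 1) :
    circleMean s r ≠ ∞ := by
  rcases hr1.lt_or_eq with h | rfl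
  · rw [circleMean_eq_tsum s hr0 h]
    refine ne_top_of_le_ne_top (circleMean_one_ne_top hs0 hs1)
      (le_trans (ENNReal.tsum_le_tsum fun n => ?_) (tsum_circleCoeff_le hs0))
    exact ENNReal.ofReal_le_ofReal
      (mul_le_of_le_one_right (circleCoeff_nonneg s n) (pow_le_one₀ hr0 hr1))
  · exact circleMean_one_ne_top hs0 hs1

theorem axialKernel_self_ne_top {s : ℝ} (hs0 : 0 < s) (hs1 : s < 1) {z : ℂ} (hz : 0 < z.re) :
    axialKernel s z z ≠ ∞ := by
  rw [axialKernel_eq_circleMean s (c := z.re) (r := 1) hz (by ring) (by ring)]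
  exact ENNReal.mul_ne_top ENNReal.ofReal_ne_top (circleMean_one_ne_top hs0 hs1)

theorem axialKernel_comm (s : ℝ) (z w : ℂ) : axialKernel s z w = axialKernel s w z := by
  rw [axialKernel_eq, axialKernel_eq]
  refine lintegral_congr fun φ => ?_
  rw [rieszKernel, rieszKernel, edist_dist, edist_dist, EuclideanSpace.dist_eq,
    EuclideanSpace.dist_eq]
  congr 3
  simp only [Fin.sum_univ_three, Real.dist_eq, sq_abs]
  simp only [rotY, embedPlane, PiLp.toLp_apply, Matrix.cons_val]
  linear_combination (z.re ^ 2 - w.re ^ 2) * Real.sin_sq_add_cos_sq φ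

theorem ofReal_mul_tsum_circleCoeff {s c : ℝ} (hc : 0 ≤ c) {r : ℝ} {f : ℕ → ℝ}
    (hf : ∀ n, c * r ^ (2 * n) = f n) :
    ENNReal.ofReal c * ∑' n, ENNReal.ofReal (circleCoeff s n * r ^ (2 * n)) =
      ∑' n, ENNReal.ofReal (circleCoeff s n * f n) := by
  rw [← ENNReal.tsum_mul_left]
  refine tsum_congr fun n => ?_
  rw [← ENNReal.ofReal_mul hc, ← hf]
  congr 1; ring

/-! ### The axial kernel on horizontal segments -/

section Horizontal

theorem rpow_neg_mul_div_pow {s x y : ℝ} (hx : 0 < x) (n : ℕ) :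
    x ^ (-s) * (y / x) ^ (2 * n) = y ^ (2 * n) * Real.exp (-(s + 2 * n) * Real.log x) := by
  have h : Real.exp (-(s + 2 * n) * Real.log x) = x ^ (-s) * (x ^ (2 * n))⁻¹ := by
    rw [Real.rpow_def_of_pos hx, ← Real.rpow_natCast x, Real.rpow_def_of_pos hx, ← Real.exp_neg,
      ← Real.exp_add]
    congr 1; push_cast; ring
  rw [h, div_pow]; field_simp

variable {s : ℝ} {z w : ℂ}

theorem axialKernel_eq_of_im_eq (hw : 0 < w.re) (hwz : w.re < z.re) (him : z.im = w.im) :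
    axialKernel s z w = ∑' n, ENNReal.ofReal
      (circleCoeff s n * (w.re ^ (2 * n) * Real.exp (-(s + 2 * n) * Real.log z.re))) := by
  have hz := hw.trans hwz
  rw [axialKernel_eq_circleMean s (c := z.re) (r := w.re / z.re) hz
    (by rw [him]; field_simp; ring) (by field_simp),
    circleMean_eq_tsum s (by positivity) ((div_lt_one hz).2 hwz)]
  exact ofReal_mul_tsum_circleCoeff (by positivity) (rpow_neg_mul_div_pow hz)

/-- This version includes `z = w`, which is needed because a neighbour of the gap may coincide with
`y`; there the series is only known to be a lower bound. -/
theorem tsum_le_axialKernel_of_im_eq (hs : 0 < s) (hw : 0 < w.re) (hwz : w.re ≤ z.re)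
    (him : z.im = w.im) :
    ∑' n, ENNReal.ofReal
      (circleCoeff s n * (w.re ^ (2 * n) * Real.exp (-(s + 2 * n) * Real.log z.re))) ≤
      axialKernel s z w := by
  have hz := hw.trans_le hwz
  rw [axialKernel_eq_circleMean s (c := z.re) (r := w.re / z.re) hz
    (by rw [him]; field_simp; ring) (by field_simp),
    ← ofReal_mul_tsum_circleCoeff (c := z.re ^ (-s)) (by positivity) (rpow_neg_mul_div_pow hz)]
  gcongr
  exact tsum_le_circleMean hs (by positivity) ((div_le_one hz).2 hwz)

theorem axialKernel_ne_top_of_im_eq (hs0 : 0 < s) (hs1 : s < 1) (hw : 0 < w.re)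
    (hwz : w.re ≤ z.re) (him : z.im = w.im) : axialKernel s z w ≠ ∞ := by
  have hz := hw.trans_le hwz
  rw [axialKernel_eq_circleMean s (c := z.re) (r := w.re / z.re) hz
    (by rw [him]; field_simp; ring) (by field_simp)]
  exact ENNReal.mul_ne_top ENNReal.ofReal_ne_top
    (circleMean_ne_top hs0 hs1 (by positivity) ((div_le_one hz).2 hwz))

/-- With `y` on the left the terms are `y^{2n} x^{-(s+2n)}`, strictly convex by concavity of `log`.
With `y` on the right, symmetry exchanges the roles and the terms are multiples of `x^{2n}`, convex
for all `n` and strictly so for `n = 1`. -/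
theorem axialKernel_horizontal_convex (hs0 : 0 < s) (hs1 : s < 1) {y x₀ x₁ x₂ : ℂ}
    (hy : 0 < y.re) (hx₁ : 0 < x₁.re) (h₀ : x₀.im = y.im) (h₁ : x₁.im = y.im)
    (h₂ : x₂.im = y.im) {t u : ℝ} (ht : 0 < t) (hu : 0 < u) (htu : t + u = 1)
    (hx : x₀.re = t * x₁.re + u * x₂.re) (hlt : x₁.re < x₂.re)
    (hside : y.re ≤ x₁.re ∨ x₂.re ≤ y.re) :
    axialKernel s x₀ y <
      ENNReal.ofReal t * axialKernel s x₁ y + ENNReal.ofReal u * axialKernel s x₂ y := by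
  have hx₂ : 0 < x₂.re := hx₁.trans hlt
  have h10 : x₁.re < x₀.re := by
    have : x₀.re - x₁.re = u * (x₂.re - x₁.re) := by
      rw [hx]; linear_combination x₁.re * htu
    nlinarith [mul_pos hu (sub_pos.2 hlt)]
  have h02 : x₀.re < x₂.re := by
    have : x₂.re - x₀.re = t * (x₂.re - x₁.re) := by
      rw [hx]; linear_combination -x₂.re * htu
    nlinarith [mul_pos ht (sub_pos.2 hlt)]
  have hx₀ : 0 < x₀.re := hx₁.trans h10
  have ha := circleCoeff_nonneg s
  have ha1 := circleCoeff_one_pos hs0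
  rcases hside with hside | hside
  · have hfin := axialKernel_ne_top_of_im_eq hs0 hs1 hy (hside.trans h10.le) h₀
    rw [axialKernel_eq_of_im_eq hy (hside.trans_lt h10) h₀] at hfin ⊢
    have hstrict : ∀ n : ℕ, y.re ^ (2 * n) * Real.exp (-(s + 2 * n) * Real.log x₀.re) <
        t * (y.re ^ (2 * n) * Real.exp (-(s + 2 * n) * Real.log x₁.re)) +
          u * (y.re ^ (2 * n) * Real.exp (-(s + 2 * n) * Real.log x₂.re)) := by
      intro n
      have h := exp_neg_mul_lt_of_strictConcaveOn strictConcaveOn_log_Ioi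
        (p := s + 2 * n) (by positivity) (mem_Ioi.2 hx₁) (mem_Ioi.2 hx₂) hlt.ne ht hu htu
      rw [← hx] at h
      have := mul_lt_mul_of_pos_left h (pow_pos hy (2 * n))
      linarith
    refine (tsum_ofReal_lt_tsum ha ha1 (fun n => by positivity)
      (fun n => (hstrict n).le) (hstrict 1) hfin).trans_le ?_
    rw [tsum_ofReal_mul_add ha (fun n => by positivity) (fun n => by positivity) ht.le hu.le]
    gcongr
    · exact tsum_le_axialKernel_of_im_eq hs0 hy hside h₁
    · exact tsum_le_axialKernel_of_im_eq hs0 hy (hside.trans hlt.le) h₂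
  · rw [axialKernel_comm s x₀, axialKernel_comm s x₁, axialKernel_comm s x₂]
    have hfin := axialKernel_ne_top_of_im_eq hs0 hs1 hx₀ (h02.le.trans hside) h₀.symm
    rw [axialKernel_eq_of_im_eq hx₀ (h02.trans_le hside) h₀.symm] at hfin ⊢
    have hle : ∀ n : ℕ, x₀.re ^ (2 * n) ≤ t * x₁.re ^ (2 * n) + u * x₂.re ^ (2 * n) := by
      intro n
      rw [hx]
      exact (convexOn_pow (2 * n)).2 (mem_Ici.2 hx₁.le) (mem_Ici.2 hx₂.le) ht.le hu.le htu
    have hlt1 : x₀.re ^ (2 * 1) < t * x₁.re ^ (2 * 1) + u * x₂.re ^ (2 * 1) := by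
      rw [hx]
      exact (strictConvexOn_pow (n := 2 * 1) (by norm_num)).2 (mem_Ici.2 hx₁.le)
        (mem_Ici.2 hx₂.le) hlt.ne ht hu htu
    refine (tsum_ofReal_lt_tsum (g := fun n =>
      t * (x₁.re ^ (2 * n) * Real.exp (-(s + 2 * n) * Real.log y.re)) +
        u * (x₂.re ^ (2 * n) * Real.exp (-(s + 2 * n) * Real.log y.re)))
      ha ha1 (fun n => by positivity) (fun n => ?_) ?_ hfin).trans_le ?_
    · have := mul_le_mul_of_nonneg_right (hle n)
        (Real.exp_pos (-(s + 2 * n) * Real.log y.re)).le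
      linarith
    · have := mul_lt_mul_of_pos_right hlt1
        (Real.exp_pos (-(s + 2 * (1 : ℕ)) * Real.log y.re))
      linarith
    · rw [tsum_ofReal_mul_add ha (fun n => by positivity) (fun n => by positivity) ht.le hu.le]
      gcongr
      · exact tsum_le_axialKernel_of_im_eq hs0 hx₁ (hlt.le.trans hside) h₁.symm
      · exact tsum_le_axialKernel_of_im_eq hs0 hx₂ hside h₂.symm

theorem axialKernel_horizontal_lt_right (hs0 : 0 < s) (hs1 : s < 1) {y x₀ x₁ : ℂ}
    (hy : 0 < y.re) (h₀ : x₀.im = y.im) (h₁ : x₁.im = y.im)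
    (hyx : y.re ≤ x₁.re) (hlt : x₁.re < x₀.re) : axialKernel s x₀ y < axialKernel s x₁ y := by
  have hfin := axialKernel_ne_top_of_im_eq hs0 hs1 hy (hyx.trans hlt.le) h₀
  rw [axialKernel_eq_of_im_eq hy (hyx.trans_lt hlt) h₀] at hfin ⊢
  have hstrict : ∀ n : ℕ, y.re ^ (2 * n) * Real.exp (-(s + 2 * n) * Real.log x₀.re) <
      y.re ^ (2 * n) * Real.exp (-(s + 2 * n) * Real.log x₁.re) := by
    intro n
    refine mul_lt_mul_of_pos_left (Real.exp_lt_exp.2 ?_) (pow_pos hy _)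
    have hp : 0 < s + 2 * n := by positivity
    have := mul_lt_mul_of_pos_left (Real.log_lt_log (hy.trans_le hyx) hlt) hp
    linarith
  exact (tsum_ofReal_lt_tsum (circleCoeff_nonneg s) (circleCoeff_one_pos hs0)
    (fun n => by positivity) (fun n => (hstrict n).le) (hstrict 1) hfin).trans_le
    (tsum_le_axialKernel_of_im_eq hs0 hy hyx h₁)

theorem axialKernel_horizontal_lt_left (hs0 : 0 < s) (hs1 : s < 1) {y x₀ x₂ : ℂ}
    (hx₀ : 0 < x₀.re) (h₀ : x₀.im = y.im) (h₂ : x₂.im = y.im)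
    (hyx : x₂.re ≤ y.re) (hlt : x₀.re < x₂.re) : axialKernel s x₀ y < axialKernel s x₂ y := by
  rw [axialKernel_comm s x₀, axialKernel_comm s x₂]
  have hfin := axialKernel_ne_top_of_im_eq hs0 hs1 hx₀ (hlt.le.trans hyx) h₀.symm
  rw [axialKernel_eq_of_im_eq hx₀ (hlt.trans_le hyx) h₀.symm] at hfin ⊢
  refine (tsum_ofReal_lt_tsum (circleCoeff_nonneg s) (circleCoeff_one_pos hs0)
    (fun n => by positivity) (fun n => ?_) ?_ hfin).trans_le
    (tsum_le_axialKernel_of_im_eq hs0 (hx₀.trans hlt) hyx h₂.symm)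
  · gcongr
  · gcongr

end Horizontal

/-! ### The axial kernel on vertical segments -/

section Vertical

variable {s : ℝ} {z w : ℂ} {R : ℝ}

/-- The values `c = R eˣ` and `r = e⁻²ˣ` give `c² r = R²` and `c² (1 + r²) = R² (2 + 4 sinh² x)`.
Matching the distance forces `2R sinh x = |z.im - w.im|`; the absolute value ensures `r ≤ 1`. -/
theorem axialKernel_eq_circleMean_of_re_eq (hR : 0 < R) (hz : z.re = R) (hw : w.re = R) :
    axialKernel s z w =
      ENNReal.ofReal ((R * Real.exp (Real.arsinh (|z.im - w.im| / (2 * R)))) ^ (-s)) *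
        circleMean s (Real.exp (-(2 * Real.arsinh (|z.im - w.im| / (2 * R))))) := by
  set x := |z.im - w.im| / (2 * R) with hx
  have h1 := Real.sinh_arsinh x
  rw [Real.sinh_eq] at h1
  have h2 : Real.exp (-(2 * Real.arsinh x)) = Real.exp (-Real.arsinh x) ^ 2 := by
    rw [← Real.exp_nat_mul]; congr 1; push_cast; ring
  have h3 : Real.exp (Real.arsinh x) * Real.exp (-Real.arsinh x) = 1 := by
    rw [← Real.exp_add]; simp
  have h4 : (2 * R * x) ^ 2 = (z.im - w.im) ^ 2 := by
    rw [hx, mul_div_cancel₀ _ (by positivity), sq_abs]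
  apply axialKernel_eq_circleMean s (by positivity)
  · rw [h2, hz, hw, ← h4]
    set p := Real.exp (Real.arsinh x)
    set q := Real.exp (-Real.arsinh x)
    linear_combination R ^ 2 * (p * q * q ^ 2 + q ^ 2 + 2) * h3 +
      4 * R ^ 2 * ((p - q) / 2 + x) * h1
  · rw [h2, hz, hw]
    set p := Real.exp (Real.arsinh x)
    set q := Real.exp (-Real.arsinh x)
    linear_combination R ^ 2 * (p * q + 1) * h3

theorem rpow_neg_mul_exp_pow (hR : 0 < R) (x : ℝ) (n : ℕ) :
    (R * Real.exp x) ^ (-s) * Real.exp (-(2 * x)) ^ (2 * n) =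
      R ^ (-s) * Real.exp (-(s + 4 * n) * x) := by
  rw [Real.mul_rpow hR.le (Real.exp_pos x).le, ← Real.exp_mul, ← Real.exp_nat_mul, mul_assoc,
    ← Real.exp_add]
  congr 2; push_cast; ring

theorem axialKernel_eq_of_re_eq (hR : 0 < R) (hz : z.re = R) (hw : w.re = R)
    (hne : z.im ≠ w.im) :
    axialKernel s z w = ∑' n, ENNReal.ofReal (circleCoeff s n *
      (R ^ (-s) * Real.exp (-(s + 4 * n) * Real.arsinh (|z.im - w.im| / (2 * R))))) := by
  have h0 : 0 < |z.im - w.im| / (2 * R) := by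
    have := abs_pos.2 (sub_ne_zero.2 hne)
    positivity
  have h1 := Real.arsinh_pos_iff.2 h0
  rw [axialKernel_eq_circleMean_of_re_eq hR hz hw, circleMean_eq_tsum s (Real.exp_pos _).le
    (by rw [Real.exp_lt_one_iff]; linarith)]
  exact ofReal_mul_tsum_circleCoeff (by positivity) (rpow_neg_mul_exp_pow hR _)

theorem exp_neg_two_mul_arsinh_le_one (hR : 0 < R) (h : ℝ) :
    Real.exp (-(2 * Real.arsinh (|h| / (2 * R)))) ≤ 1 := by
  have := Real.arsinh_nonneg_iff.2 (show 0 ≤ |h| / (2 * R) by positivity)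
  rw [Real.exp_le_one_iff]; linarith

theorem tsum_le_axialKernel_of_re_eq (hs : 0 < s) (hR : 0 < R) (hz : z.re = R)
    (hw : w.re = R) :
    ∑' n, ENNReal.ofReal (circleCoeff s n *
      (R ^ (-s) * Real.exp (-(s + 4 * n) * Real.arsinh (|z.im - w.im| / (2 * R))))) ≤
      axialKernel s z w := by
  rw [axialKernel_eq_circleMean_of_re_eq hR hz hw, ← ofReal_mul_tsum_circleCoeff
    (by positivity) (rpow_neg_mul_exp_pow hR (Real.arsinh (|z.im - w.im| / (2 * R))))]
  gcongr
  exact tsum_le_circleMean hs (Real.exp_pos _).le (exp_neg_two_mul_arsinh_le_one hR _)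

theorem axialKernel_ne_top_of_re_eq (hs0 : 0 < s) (hs1 : s < 1) (hR : 0 < R) (hz : z.re = R)
    (hw : w.re = R) : axialKernel s z w ≠ ∞ := by
  rw [axialKernel_eq_circleMean_of_re_eq hR hz hw]
  exact ENNReal.mul_ne_top ENNReal.ofReal_ne_top (circleMean_ne_top hs0 hs1 (Real.exp_pos _).le
    (exp_neg_two_mul_arsinh_le_one hR _))

theorem axialKernel_vertical_convex (hs0 : 0 < s) (hs1 : s < 1) (hR : 0 < R) {y x₀ x₁ x₂ : ℂ}
    (hy : y.re = R) (h₀ : x₀.re = R) (h₁ : x₁.re = R) (h₂ : x₂.re = R) {t u : ℝ} (ht : 0 < t)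
    (hu : 0 < u) (htu : t + u = 1) (hx : x₀.im = t * x₁.im + u * x₂.im) (hlt : x₁.im < x₂.im)
    (hside : y.im ≤ x₁.im ∨ x₂.im ≤ y.im) :
    axialKernel s x₀ y <
      ENNReal.ofReal t * axialKernel s x₁ y + ENNReal.ofReal u * axialKernel s x₂ y := by
  have h10 : x₁.im < x₀.im := by
    have : x₀.im - x₁.im = u * (x₂.im - x₁.im) := by
      rw [hx]; linear_combination x₁.im * htu
    nlinarith [mul_pos hu (sub_pos.2 hlt)]
  have h02 : x₀.im < x₂.im := by
    have : x₂.im - x₀.im = t * (x₂.im - x₁.im) := by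
      rw [hx]; linear_combination -x₂.im * htu
    nlinarith [mul_pos ht (sub_pos.2 hlt)]
  have ha := circleCoeff_nonneg s
  have hne : x₀.im ≠ y.im := by
    rcases hside with h | h
    · exact (h.trans_lt h10).ne'
    · exact (h02.trans_le h).ne
  -- All three points lie on one side of `y`, so distance to `y` is affine there and convexity in
  -- the distance suffices.
  have habs : |x₀.im - y.im| = t * |x₁.im - y.im| + u * |x₂.im - y.im| ∧
      |x₁.im - y.im| ≠ |x₂.im - y.im| := by
    rcases hside with h | h
    · rw [abs_of_nonneg (by linarith), abs_of_nonneg (by linarith), abs_of_nonneg (by linarith)]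
      exact ⟨by rw [hx]; linear_combination y.im * htu, by intro h'; linarith⟩
    · rw [abs_of_nonpos (by linarith), abs_of_nonpos (by linarith), abs_of_nonpos (by linarith)]
      exact ⟨by rw [hx]; linear_combination -y.im * htu, by intro h'; linarith⟩
  have hfin := axialKernel_ne_top_of_re_eq hs0 hs1 hR h₀ hy
  rw [axialKernel_eq_of_re_eq hR h₀ hy hne] at hfin ⊢
  have hstrict : ∀ n : ℕ,
      R ^ (-s) * Real.exp (-(s + 4 * n) * Real.arsinh (|x₀.im - y.im| / (2 * R))) <
      t * (R ^ (-s) * Real.exp (-(s + 4 * n) * Real.arsinh (|x₁.im - y.im| / (2 * R)))) +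
      u * (R ^ (-s) * Real.exp (-(s + 4 * n) * Real.arsinh (|x₂.im - y.im| / (2 * R)))) := by
    intro n
    have h := exp_neg_mul_lt_of_strictConcaveOn strictConcaveOn_arsinh
      (p := s + 4 * n) (by positivity)
      (x₁ := |x₁.im - y.im| / (2 * R)) (x₂ := |x₂.im - y.im| / (2 * R))
      (mem_Ici.2 (by positivity)) (mem_Ici.2 (by positivity))
      (fun h => habs.2 ((div_left_inj' (by positivity)).1 h)) ht hu htu
    rw [← mul_div_assoc, ← mul_div_assoc, ← add_div, ← habs.1] at h
    have := mul_lt_mul_of_pos_left h (Real.rpow_pos_of_pos hR (-s))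
    linarith
  refine (tsum_ofReal_lt_tsum ha (circleCoeff_one_pos hs0) (fun n => by positivity)
    (fun n => (hstrict n).le) (hstrict 1) hfin).trans_le ?_
  rw [tsum_ofReal_mul_add ha (fun n => by positivity) (fun n => by positivity) ht.le hu.le]
  gcongr
  · exact tsum_le_axialKernel_of_re_eq hs0 hR h₁ hy
  · exact tsum_le_axialKernel_of_re_eq hs0 hR h₂ hy

theorem axialKernel_vertical_lt (hs0 : 0 < s) (hs1 : s < 1) (hR : 0 < R) {y x₀ x₁ : ℂ}
    (hy : y.re = R) (h₀ : x₀.re = R) (h₁ : x₁.re = R)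
    (hlt : |x₁.im - y.im| < |x₀.im - y.im|) : axialKernel s x₀ y < axialKernel s x₁ y := by
  have hne : x₀.im ≠ y.im := by
    intro h
    rw [h, sub_self, abs_zero] at hlt
    exact (abs_nonneg _).not_gt hlt
  have hfin := axialKernel_ne_top_of_re_eq hs0 hs1 hR h₀ hy
  rw [axialKernel_eq_of_re_eq hR h₀ hy hne] at hfin ⊢
  have hstrict : ∀ n : ℕ,
      R ^ (-s) * Real.exp (-(s + 4 * n) * Real.arsinh (|x₀.im - y.im| / (2 * R))) <
      R ^ (-s) * Real.exp (-(s + 4 * n) * Real.arsinh (|x₁.im - y.im| / (2 * R))) := by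
    intro n
    refine mul_lt_mul_of_pos_left (Real.exp_lt_exp.2 ?_) (Real.rpow_pos_of_pos hR _)
    have hp : 0 < s + 4 * n := by positivity
    have h1 : Real.arsinh (|x₁.im - y.im| / (2 * R)) < Real.arsinh (|x₀.im - y.im| / (2 * R)) :=
      Real.arsinh_lt_arsinh.2 (by gcongr)
    have := mul_lt_mul_of_pos_left h1 hp
    linarith
  exact (tsum_ofReal_lt_tsum (circleCoeff_nonneg s) (circleCoeff_one_pos hs0)
    (fun n => by positivity) (fun n => (hstrict n).le) (hstrict 1) hfin).trans_le
    (tsum_le_axialKernel_of_re_eq hs0 hR h₁ hy)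

end Vertical

/-! ### Conclusion -/

/-- Written as one integral over `(w, φ)`, the potential has the continuous Riesz kernel as
integrand, so Fatou applies without continuity of `axialKernel`. -/
theorem isClosed_setOf_axialPotential_le (s : ℝ) (μ : Measure ℂ) [SFinite μ] (c : ℝ≥0∞) :
    IsClosed {z | ∫⁻ w, axialKernel s z w ∂μ ≤ c} := by
  have h : ∀ z, ∫⁻ w, axialKernel s z w ∂μ = ∫⁻ x : ℂ × ℝ,
      rieszKernel s (rotY x.2 (embedPlane z)) (embedPlane x.1) ∂(μ.prod angleMeasure) := by
    intro z
    simp_rw [axialKernel_eq]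
    rw [lintegral_prod]
    exact (Continuous.measurable (by fun_prop)).aemeasurable
  simp_rw [h]
  exact isClosed_setOf_lintegral_le _ (fun x => by fun_prop)
    (fun z => Continuous.measurable (by fun_prop)) c

theorem kernelEnergy_ne_top_of_isEquilibriumMeasure {X : Type*} [MeasurableSpace X]
    [MeasurableSingletonClass X] {k : X → X → ℝ≥0∞} {K : Set X} {μ : Measure X}
    (hμ : IsEquilibriumMeasure k K μ) {x : X} (hx : x ∈ K) (hxx : k x x ≠ ∞) :
    kernelEnergy k μ ≠ ∞ := by
  have h := hμ.energy_le (Measure.dirac x) inferInstance (by simp [hx])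
  rw [kernelEnergy, kernelEnergy, lintegral_dirac, lintegral_dirac] at h
  exact ne_top_of_le_ne_top hxx h

end

theorem corollary3p3 (A : Set ℂ) (hA : IsCompact A) (hA_nonempty : A.Nonempty)
    (hA_segment :
      (∃ a b c : ℝ, 0 < a ∧ a < b ∧ A ⊆ segment ℝ (⟨a, c⟩ : ℂ) ⟨b, c⟩) ∨
      (∃ R c d : ℝ, 0 < R ∧ c < d ∧ A ⊆ segment ℝ (⟨R, c⟩ : ℂ) ⟨R, d⟩))
    (s : ℝ) (hs₀ : 0 < s) (hs₁ : s < 1) :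
    ∃ μ : Measure (EuclideanSpace ℝ (Fin 3)),
      -- the Riesz equilibrium measure on the set of revolution exists and is unique
      (IsEquilibriumMeasure (rieszKernel s) (revolve A) μ ∧
        ∀ μ' : Measure (EuclideanSpace ℝ (Fin 3)),
          IsEquilibriumMeasure (rieszKernel s) (revolve A) μ' → μ' = μ) ∧
      -- the induced measure on `A` is the unique equilibrium measure for the planar kernel
      (IsEquilibriumMeasure (axialKernel s) A (measureOnSection μ) ∧
        ∀ ν : Measure ℂ, IsEquilibriumMeasure (axialKernel s) A ν → ν = measureOnSection μ) ∧
      -- its support is all of `A`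
      (measureOnSection μ).support = A := by
  have hre : ∀ z ∈ A, 0 < z.re := by
    rcases hA_segment with ⟨a, b, c, ha, hab, hseg⟩ | ⟨R, c, d, hR, -, hseg⟩
    · intro z hz
      obtain ⟨t, u, ht, hu, htu, rfl⟩ := hseg hz
      simp only [Complex.add_re, Complex.real_smul, Complex.re_ofReal_mul]
      nlinarith
    · intro z hz
      obtain ⟨t, u, ht, hu, htu, rfl⟩ := hseg hz
      simp only [Complex.add_re, Complex.real_smul, Complex.re_ofReal_mul]
      rw [← add_mul, htu, one_mul]
      exact hR
  have hA' : A ⊆ rightHalfPlane := fun z hz => (hre z hz).le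
  have hdiag : ∀ z ∈ A, axialKernel s z z ≠ ∞ := fun z hz =>
    axialKernel_self_ne_top hs₀ hs₁ (hre z hz)
  have hAm : MeasurableSet A := hA.isClosed.measurableSet
  obtain ⟨z₀, hz₀⟩ := hA_nonempty
  obtain ⟨μ, hμ⟩ := exists_isEquilibriumMeasure (continuous_rieszKernel s) (isCompact_revolve hA)
    ⟨_, z₀, hz₀, 0, ⟨le_rfl, Real.two_pi_pos⟩, rfl⟩
  have hfin : kernelEnergy (rieszKernel s) μ ≠ ∞ := by
    -- The competitor is the uniform measure on the circle through `z₀`; its energy is the diagonal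
    -- value of the axial kernel, finite since `s < 1` and the circle has positive radius.
    have h := hμ.energy_le (revolveMeasure (Measure.dirac z₀)) inferInstance (by
      rw [revolve_eq_preimage hA', ← preimage_compl,
        ← Measure.map_apply measurable_profile hAm.compl]
      change measureOnSection (revolveMeasure (Measure.dirac z₀)) Aᶜ = 0
      rw [measureOnSection_revolveMeasure]
      · simp [hz₀]
      · exact measure_mono_null (compl_subset_compl.2 hA') (by simp [hz₀]))
    have hd : kernelEnergy (axialKernel s) (Measure.dirac z₀) = axialKernel s z₀ z₀ := by
      rw [kernelEnergy, lintegral_dirac, lintegral_dirac]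
    rw [kernelEnergy_revolveMeasure, hd] at h
    exact ne_top_of_le_ne_top (hdiag z₀ hz₀) h
  obtain ⟨hsec, huniq⟩ := hμ.measureOnSection hs₀ hAm hA' hfin
  refine ⟨μ, ⟨hμ, fun μ' hμ' => (hμ.eq_of_rieszKernel hs₀ hμ' hfin).symm⟩, ⟨hsec, huniq⟩, ?_⟩
  have := hsec.isProbabilityMeasure
  have hfin' := kernelEnergy_ne_top_of_isEquilibriumMeasure hsec hz₀ (hdiag z₀ hz₀)
  rcases hA_segment with ⟨a, b, c, ha, hab, hseg⟩ | ⟨R, c, d, hR, -, hseg⟩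
  · have him : ∀ z ∈ A, z.im = c := by
      intro z hz
      obtain ⟨t, u, ht, hu, htu, rfl⟩ := hseg hz
      simp [← add_mul, htu]
    have him' : ∀ z ∈ A, ∀ w ∈ A, z.im = w.im := fun z hz w hw => by rw [him z hz, him w hw]
    refine hsec.support_eq_of_strictConvex (measurable_axialKernel s) (axialKernel_comm s) hA
      hfin' hdiag (isClosed_setOf_axialPotential_le s _) Complex.continuous_re
      (fun z hz w hw h => Complex.ext h (him' z hz w hw)) ?_ ?_ ?_
    · intro y hy x₀ hx₀ x₁ hx₁ x₂ hx₂ t u ht hu htu hx hlt hside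
      exact axialKernel_horizontal_convex hs₀ hs₁ (hre y hy) (hre x₁ hx₁) (him' _ hx₀ _ hy)
        (him' _ hx₁ _ hy) (him' _ hx₂ _ hy) ht hu htu hx hlt hside
    · intro y hy x₀ hx₀ x₁ hx₁ hyx hlt
      exact axialKernel_horizontal_lt_right hs₀ hs₁ (hre y hy) (him' _ hx₀ _ hy)
        (him' _ hx₁ _ hy) hyx hlt
    · intro y hy x₀ hx₀ x₂ hx₂ hyx hlt
      exact axialKernel_horizontal_lt_left hs₀ hs₁ (hre x₀ hx₀) (him' _ hx₀ _ hy)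
        (him' _ hx₂ _ hy) hyx hlt
  · have hR' : ∀ z ∈ A, z.re = R := by
      intro z hz
      obtain ⟨t, u, ht, hu, htu, rfl⟩ := hseg hz
      simp [← add_mul, htu]
    refine hsec.support_eq_of_strictConvex (measurable_axialKernel s) (axialKernel_comm s) hA
      hfin' hdiag (isClosed_setOf_axialPotential_le s _) Complex.continuous_im
      (fun z hz w hw h => Complex.ext (by rw [hR' z hz, hR' w hw]) h) ?_ ?_ ?_
    · intro y hy x₀ hx₀ x₁ hx₁ x₂ hx₂ t u ht hu htu hx hlt hside
      exact axialKernel_vertical_convex hs₀ hs₁ hR (hR' _ hy) (hR' _ hx₀) (hR' _ hx₁)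
        (hR' _ hx₂) ht hu htu hx hlt hside
    · intro y hy x₀ hx₀ x₁ hx₁ hyx hlt
      refine axialKernel_vertical_lt hs₀ hs₁ hR (hR' _ hy) (hR' _ hx₀) (hR' _ hx₁) ?_
      rw [abs_of_nonneg (by linarith), abs_of_nonneg (by linarith)]
      linarith
    · intro y hy x₀ hx₀ x₂ hx₂ hyx hlt
      refine axialKernel_vertical_lt hs₀ hs₁ hR (hR' _ hy) (hR' _ hx₀) (hR' _ hx₂) ?_
      rw [abs_of_nonpos (by linarith), abs_of_nonpos (by linarith)]
      linarith
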